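/- **Setting.** Let $\mathcal H$ and $\mathcal G_1,\dots,\mathcal G_m$ ($m\ge 1$) be real Hilbert spaces, $z\in\mathcal H$, $r_i\in\mathcal G_i$, let $f:\mathcal H\to(-\infty,+\infty]$ and $g_i:\mathcal G_i\to(-\infty,+\infty]$ be proper, convex and lower semicontinuous, let $L_i:\mathcal H\to\mathcal G_i$ be nonzero continuous linear operators, and let $h:\mathcal H\to\mathbb R$ be convex and differentiable with $\eta$-Lipschitz gradient, $\eta>0$. Consider the primal problem $$\inf_{x\in\mathcal H}\Big\{f(x)+\sum_{i=1}^m g_i(L_ix-r_i)+h(x)-\langle x,z\rangle\Big\}\qquad (P)$$ and its dual $$\sup_{v_i\in\mathcal G_i}\Big\{-(f^*\Box h^*)\Big(z-\sum_{i=1}^m L_i^*v_i\Big)-\sum_{i=1}^m\big(g_i^*(v_i)+\langle v_i,r_i\rangle\big)\Big\},\qquad (D)$$ where $f^*(u)=\sup_x\{\langle u,x\rangle-f(x)\}$ denotes the conjugate and $(a\Box b)(x)=\inf_y\{a(y)+b(x-y)\}$ the infimal convolution. Write $\operatorname{dom} f=\{x: f(x)<+\infty\}$, and, for a convex set $S$,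 let $\operatorname{sqri}S$ be the set of all $x\in S$ for which $\bigcup_{t>0}t(S-x)$ is a closed linear subspace. For $t>0$, $\operatorname{prox}_{tf}(x)$ is the unique minimizer of $y\mapsto f(y)+\frac1{2t}\|y-x\|^2$. **Theorem.** Suppose that $f+h$ is $\gamma$-strongly convex for some $\gamma>0$ (that is, $f+h-\frac\gamma2\|\cdot\|^2$ is convex) and that $$(r_1,\dots,r_m)\in\operatorname{sqri}\Big(\{(L_1x,\dots,L_mx):x\in\operatorname{dom} f\}-\prod_{i=1}^m\operatorname{dom} g_i\Big).$$ Then (P) has a unique optimal solution $\bar x$, there is an optimal solution $(\bar v_1,\dots,\bar v_m)$ of (D) such that $$z-\sum_{i=1}^mL_i^*\bar v_i\in\partial f(\bar x)+\nabla h(\bar x),\qquad \bar v_i\in\partial g_i(L_i\bar x-r_i),\ i=1,\dots,m,\qquad(\mathrm{OC})$$ and the optimal objective values of (P) and (D) coincide. Moreover, let $\tau_0>0$, $\sigma_{i,0}>0$ and $\lambda$ be such that $\tau_0<2\gamma/\eta$, $\lambda\ge\eta+1$ and $\tau_0\sum_{i=1}^m\sigma_{i,0}\|L_i\|^2\le\sqrt{1+\tau_0(2\gamma-\eta\tau_0)/\lambda}$,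 let $(x_0,v_{1,0},\dots,v_{m,0})\in\mathcal H\times\mathcal G_1\times\dots\times\mathcal G_m$, and for $n\ge0$ set $$\begin{aligned}x_{n+1}&=\operatorname{prox}_{(\tau_n/\lambda)f}\Big[x_n-\tfrac{\tau_n}\lambda\Big(\sum_{i=1}^mL_i^*v_{i,n}+\nabla h(x_n)-z\Big)\Big],\\ \theta_n&=1/\sqrt{1+\tau_n(2\gamma-\eta\tau_n)/\lambda},\\ y_n&=x_{n+1}+\theta_n(x_{n+1}-x_n),\\ v_{i,n+1}&=\operatorname{prox}_{\sigma_{i,n}g_i^*}\big[v_{i,n}+\sigma_{i,n}(L_iy_n-r_i)\big],\quad i=1,\dots,m,\\ \tau_{n+1}&=\theta_n\tau_n,\qquad \sigma_{i,n+1}=\sigma_{i,n}/\theta_{n+1},\quad i=1,\dots,m.\end{aligned}$$ Then, for every $(\bar v_1,\dots,\bar v_m)$ satisfying (OC) together with $\bar x$ and for every $n\ge0$, $$\begin{aligned}&\frac{\lambda\|x_{n+1}-\bar x\|^2}{\tau_{n+1}^2}+\Big(1-\tau_1\sum_{i=1}^m\sigma_{i,0}\|L_i\|^2\Big)\sum_{i=1}^m\frac{\|v_{i,n}-\bar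 v_i\|^2}{\tau_1\sigma_{i,0}}\\&\quad\le\frac{\lambda\|x_1-\bar x\|^2}{\tau_1^2}+\sum_{i=1}^m\frac{\|v_{i,0}-\bar v_i\|^2}{\tau_1\sigma_{i,0}}+\frac{\|x_1-x_0\|^2}{\tau_0^2}+\frac2{\tau_0}\sum_{i=1}^m\langle L_i(x_1-x_0),v_{i,0}-\bar v_i\rangle.\end{aligned}$$ Furthermore $\lim_{n\to\infty}n\tau_n=\lambda/\gamma$, and $\|x_n-\bar x\|=O(1/n)$. -/

import Mathlib

open Filter Topology Asymptotics
open scoped Pointwise Gradient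

noncomputable section

namespace PrimalDual

section SingleFunction

variable {H : Type*} [NormedAddCommGroup H] [InnerProductSpace ℝ H]

/-- Convexity of an extended real-valued function: its epigraph is convex. -/
def IsConvex (f : H → EReal) : Prop :=
  Convex ℝ {p : H × ℝ | f p.1 ≤ (p.2 : EReal)}

/-- The effective domain. -/
def dom (f : H → EReal) : Set H := {x | f x < ⊤}

/-- Properness: nonempty effective domain, and the value `-∞` is never attained. -/
def IsProper (f : H → EReal) : Prop := (dom f).Nonempty ∧ ∀ x, f x ≠ ⊥

/-- The class `Γ(H)` of proper, convex and lower semicontinuous functions. -/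
structure IsGamma (f : H → EReal) : Prop where
  proper : IsProper f
  convex : IsConvex f
  lsc : LowerSemicontinuous f

/-- `γ`-strong convexity: `f - (γ/2)‖·‖²` is convex. -/
def IsStronglyConvex (γ : ℝ) (f : H → EReal) : Prop :=
  IsConvex (fun x => f x - ((γ / 2 * ‖x‖ ^ 2 : ℝ) : EReal))

/-- The conjugate function `f*(u) = sup_x (⟨u, x⟩ - f x)`. -/
def conj (f : H → EReal) (u : H) : EReal := ⨆ x, ((inner ℝ u x : ℝ) : EReal) - f x

/-- The infimal convolution `(f □ g)(x) = inf_y (f y + g (x - y))`. -/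
def infConv (f g : H → EReal) (x : H) : EReal := ⨅ y, f y + g (x - y)

/-- The (convex) subdifferential; it is empty where `f` is not finite. -/
def subdiff (f : H → EReal) (x : H) : Set H :=
  {v | f x ≠ ⊤ ∧ f x ≠ ⊥ ∧ ∀ y, f x + ((inner ℝ v (y - x) : ℝ) : EReal) ≤ f y}

/-- `p` minimizes `y ↦ f y + (1 / (2 t)) ‖y - x‖²`. -/
def IsProxPoint (t : ℝ) (f : H → EReal) (x p : H) : Prop :=
  IsMinOn (fun y => f y + ((1 / (2 * t) * ‖y - x‖ ^ 2 : ℝ) : EReal)) Set.univ p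

/-- The proximal point of parameter `t` of `f` at `x`
(the minimizer exists and is unique for `f ∈ Γ(H)` and `t > 0`). -/
def prox (t : ℝ) (f : H → EReal) (x : H) : H :=
  Classical.epsilon (IsProxPoint t f x)

end SingleFunction

/-- The strong quasi-relative interior: the points `x ∈ S` for which the cone
`⋃_{t > 0} t (S - x)` is a closed linear subspace. -/
def sqri {E : Type*} [AddCommGroup E] [Module ℝ E] [TopologicalSpace E] (S : Set E) : Set E :=
  {x | x ∈ S ∧ ∃ V : Submodule ℝ E, IsClosed (V : Set E) ∧
    (⋃ (t : ℝ) (_ : 0 < t), t • (S - {x})) = (V : Set E)}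

section Problem

variable {H : Type*} [NormedAddCommGroup H] [InnerProductSpace ℝ H] [CompleteSpace H]
  {m : ℕ} {G : Fin m → Type*} [∀ i, NormedAddCommGroup (G i)]
  [∀ i, InnerProductSpace ℝ (G i)] [∀ i, CompleteSpace (G i)]

/-- The primal objective `f(x) + ∑ gᵢ(Lᵢ x - rᵢ) + h(x) - ⟨x, z⟩`. -/
def primalObj (z : H) (f : H → EReal) (h : H → ℝ) (r : ∀ i, G i) (g : ∀ i, G i → EReal)
    (L : ∀ i, H →L[ℝ] G i) (x : H) : EReal :=
  f x + (∑ i, g i (L i x - r i)) + (h x : EReal) - ((inner ℝ x z : ℝ) : EReal)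

/-- The dual objective `-(f* □ h*)(z - ∑ Lᵢ* vᵢ) - ∑ (gᵢ*(vᵢ) + ⟨vᵢ, rᵢ⟩)`. -/
def dualObj (z : H) (f : H → EReal) (h : H → ℝ) (r : ∀ i, G i) (g : ∀ i, G i → EReal)
    (L : ∀ i, H →L[ℝ] G i) (v : ∀ i, G i) : EReal :=
  -(infConv (conj f) (conj fun x => (h x : EReal)) (z - ∑ i, (L i).adjoint (v i)))
    - ∑ i, (conj (g i) (v i) + ((inner ℝ (v i) (r i) : ℝ) : EReal))

/-- The optimality conditions `z - ∑ Lᵢ* vᵢ ∈ ∂f(x) + ∇h(x)` and `vᵢ ∈ ∂gᵢ(Lᵢ x - rᵢ)`. -/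
def OptimalityConditions (z : H) (f : H → EReal) (h : H → ℝ) (r : ∀ i, G i)
    (g : ∀ i, G i → EReal) (L : ∀ i, H →L[ℝ] G i) (x : H) (v : ∀ i, G i) : Prop :=
  z - ∑ i, (L i).adjoint (v i) ∈ subdiff f x + {∇ h x} ∧
    ∀ i, v i ∈ subdiff (g i) (L i x - r i)

/-- The qualification condition
`(r₁, …, rₘ) ∈ sqri ({(L₁ x, …, Lₘ x) : x ∈ dom f} - ∏ dom gᵢ)`.
The product space carries the product topology, which is that of the Hilbert direct sum. -/
def QualificationCondition (f : H → EReal) (r : ∀ i, G i) (g : ∀ i, G i → EReal)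
    (L : ∀ i, H →L[ℝ] G i) : Prop :=
  r ∈ sqri ((fun (x : H) (i : Fin m) => L i x) '' dom f - Set.univ.pi fun i => dom (g i))

/-- The parameters `lam`, `τ`, `θ`, `σ` and the iterates `x`, `y`, `v` are those of the
accelerated primal-dual proximal algorithm (for the strong convexity constant `γ` and the
Lipschitz constant `η`), started at an arbitrary point `(x 0, v 0)`. -/
structure IsAlgorithm (z : H) (f : H → EReal) (h : H → ℝ) (r : ∀ i, G i)
    (g : ∀ i, G i → EReal) (L : ∀ i, H →L[ℝ] G i) (γ η lam : ℝ) (τ θ : ℕ → ℝ)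
    (σ : ℕ → Fin m → ℝ) (x y : ℕ → H) (v : ℕ → ∀ i, G i) : Prop where
  tau_pos : 0 < τ 0
  sigma_pos : ∀ i, 0 < σ 0 i
  tau_lt : τ 0 < 2 * γ / η
  le_lam : η + 1 ≤ lam
  step : τ 0 * ∑ i, σ 0 i * ‖L i‖ ^ 2 ≤ √(1 + τ 0 * (2 * γ - η * τ 0) / lam)
  x_succ : ∀ n, x (n + 1) = prox (τ n / lam) f
    (x n - (τ n / lam) • (∑ i, (L i).adjoint (v n i) + ∇ h (x n) - z))
  theta_eq : ∀ n, θ n = 1 / √(1 + τ n * (2 * γ - η * τ n) / lam)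
  y_eq : ∀ n, y n = x (n + 1) + θ n • (x (n + 1) - x n)
  v_succ : ∀ n i, v (n + 1) i = prox (σ n i) (conj (g i))
    (v n i + σ n i • (L i (y n) - r i))
  tau_succ : ∀ n, τ (n + 1) = θ n * τ n
  sigma_succ : ∀ n i, σ (n + 1) i = σ n i / θ (n + 1)

end Problem

end PrimalDual

end

open PrimalDual

/-! Duality. Let φ(y) be the infimum over x of the primal objective with r replaced by r - y. Strong
convexity of f + h makes the epigraph of the perturbed objective uniformly convex in the direction
of x, so its projection along x is closed (`isClosed_image_snd_of_uniformlyConvex`). That projection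
is therefore the epigraph of φ, and the infimum at y = 0 is attained, at one point only. The
qualification condition says that, up to sign, the domain of φ spans a closed subspace V as a cone.
Baire's theorem in V bounds φ above near 0, and Hahn–Banach yields a subgradient of φ at 0
(`exists_subgradient_of_cone_closed`), whose Riesz coordinates form the multiplier. Testing this
subgradient with two kinds of perturbation gives the optimality conditions (`exists_solution`).
Under these, every Fenchel–Young inequality behind `weak_duality` becomes an equality, which closes
the duality gap.

Algorithm. Each proximal step is a subgradient inclusion. Comparing it with the optimality
conditions, by strong monotonicity of ∂(f + h) on the primal side and monotonicity of ∂gᵢ* on the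
dual side, gives `primal_step` and `dual_step`. The choice of θ makes the gain 2γ - ητ exactly the
growth of the weight λ/τ², and the extrapolation y makes the coupling terms telescope, so `energy`
is nonincreasing. Cauchy–Schwarz bounds the remaining coupling term of `energy` from below and gives
`estimate`.

Rate. The increments of 1/τ converge to γ/λ, so Cesàro means give nτ → λ/γ, and `estimate` bounds
the primal error by a multiple of τ. -/

namespace PrimalDual

/-! ### Closedness of projections under uniform convexity -/

section Projection

/-- The projection of a closed set along a direction in which it is uniformly convex is closed. -/
theorem isClosed_image_snd_of_uniformlyConvex {H Y : Type*} [NormedAddCommGroup H]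
    [NormedSpace ℝ H] [CompleteSpace H] [NormedAddCommGroup Y] [NormedSpace ℝ Y]
    {E : Set (H × Y × ℝ)} (hE : IsClosed E) {κ : ℝ} (hκ : 0 < κ)
    (hmid : ∀ p ∈ E, ∀ q ∈ E, ((1 / 2 : ℝ) • p.1 + (1 / 2 : ℝ) • q.1,
      (1 / 2 : ℝ) • p.2.1 + (1 / 2 : ℝ) • q.2.1,
      1 / 2 * p.2.2 + 1 / 2 * q.2.2 - κ * ‖p.1 - q.1‖ ^ 2) ∈ E)
    (hup : ∀ x y t s, (x, y, t) ∈ E → t ≤ s → (x, y, s) ∈ E)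
    {b : Y → ℝ} (hb : Continuous b) (hbE : ∀ p ∈ E, b p.2.1 ≤ p.2.2) :
    IsClosed (Prod.snd '' E) := by
  set P := Prod.snd '' E with hP
  refine isClosed_of_closure_subset ?_
  rintro ⟨y, a⟩ ha
  have hPb : closure P ⊆ {q : Y × ℝ | b q.1 ≤ q.2} := by
    refine closure_minimal ?_ (isClosed_le (hb.comp continuous_fst) continuous_snd)
    rintro _ ⟨p, hp, rfl⟩
    exact hbE p hp
  set T := {t : ℝ | (y, t) ∈ closure P} with hT
  have hTc : IsClosed T := isClosed_closure.preimage (by fun_prop : Continuous fun t : ℝ => (y, t))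
  have hTb : BddBelow T := ⟨b y, fun t ht => hPb ht⟩
  have hcT : sInf T ∈ T := hTc.csInf_mem ⟨a, ha⟩ hTb
  set c := sInf T with hc
  have hca : c ≤ a := csInf_le hTb ha
  obtain ⟨u, huP, hu⟩ := mem_closure_iff_seq_limit.1 hcT
  choose p hpE hpu using huP
  have hcau : CauchySeq fun n => (p n).1 := by
    rw [Metric.cauchySeq_iff]
    intro ε hε
    -- Two late terms have heights below c + δ. If their first components were ε apart, their
    -- midpoint could be lowered by κε² = 2δ, to height c - δ, which is impossible near y because c
    -- is the least height over y in the closure.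
    have hδ : 0 < κ * ε ^ 2 / 2 := by positivity
    set δ := κ * ε ^ 2 / 2 with hδ'
    have hnot : (y, c - δ) ∉ closure P := fun hmem => by
      have : c ≤ c - δ := csInf_le hTb hmem
      linarith
    rw [Metric.mem_closure_iff] at hnot
    push Not at hnot
    obtain ⟨ρ, hρ, hnot⟩ := hnot
    obtain ⟨N, hN⟩ := Metric.tendsto_atTop.1 hu (min ρ δ) (lt_min hρ hδ)
    refine ⟨N, fun m hm n hn => ?_⟩
    by_contra hcon
    rw [dist_eq_norm] at hcon
    push Not at hcon
    have key := hmid _ (hpE m) _ (hpE n)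
    have hm1 := hN m hm
    have hn1 := hN n hn
    rw [← hpu, Prod.dist_eq, max_lt_iff, lt_min_iff, lt_min_iff] at hm1 hn1
    obtain ⟨⟨hm1, -⟩, -, hm2⟩ := hm1
    obtain ⟨⟨hn1, -⟩, -, hn2⟩ := hn1
    rw [Real.dist_eq, abs_lt] at hm2 hn2
    rw [dist_eq_norm] at hm1 hn1
    simp only at hm1 hm2 hn1 hn2
    have hsq : ε ^ 2 ≤ ‖(p m).1 - (p n).1‖ ^ 2 := by gcongr
    have hle : 1 / 2 * (p m).2.2 + 1 / 2 * (p n).2.2 - κ * ‖(p m).1 - (p n).1‖ ^ 2 ≤ c - δ := by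
      have := mul_le_mul_of_nonneg_left hsq hκ.le
      linarith
    have hmem := hup _ _ _ _ key hle
    have := hnot _ ⟨_, hmem, rfl⟩
    rw [Prod.dist_eq, dist_self, max_eq_left dist_nonneg, dist_comm, dist_eq_norm] at this
    have heq : (1 / 2 : ℝ) • (p m).2.1 + (1 / 2 : ℝ) • (p n).2.1 - y =
        (1 / 2 : ℝ) • ((p m).2.1 - y) + (1 / 2 : ℝ) • ((p n).2.1 - y) := by
      module
    rw [heq] at this
    have h3 := norm_add_le ((1 / 2 : ℝ) • ((p m).2.1 - y)) ((1 / 2 : ℝ) • ((p n).2.1 - y))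
    rw [norm_smul, norm_smul] at h3
    norm_num at h3
    linarith
  obtain ⟨x, hx⟩ := cauchySeq_tendsto_of_complete hcau
  have hlim : Tendsto p atTop (𝓝 (x, y, c)) := by
    have h1 : Tendsto (fun n => (p n).2) atTop (𝓝 (y, c)) := by simpa only [hpu] using hu
    exact hx.prodMk_nhds h1
  have hmem : (x, y, c) ∈ E := hE.mem_of_tendsto hlim (Eventually.of_forall hpE)
  exact ⟨(x, y, a), hup _ _ _ _ hmem hca, rfl⟩

end Projection

/-! ### Subgradients of the value function -/

section ValueFunction

variable {Y : Type*} [NormedAddCommGroup Y] [NormedSpace ℝ Y]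

/-- Countably many dilates of B cover the complete space, so by Baire one of them, hence B itself,
has an interior point. -/
theorem zero_mem_interior_of_absorbing [CompleteSpace Y] {B : Set Y} (hB : IsClosed B)
    (hconv : Convex ℝ B) (habs : ∀ y, ∃ t : ℝ, 0 < t ∧ t • y ∈ B) : (0 : Y) ∈ interior B := by
  have h0 : (0 : Y) ∈ B := by
    obtain ⟨t, -, h⟩ := habs 0
    simpa using h
  have hcover : ⋃ n : ℕ, (fun y : Y => ((n : ℝ) + 1)⁻¹ • y) ⁻¹' B = Set.univ := by
    refine Set.eq_univ_of_forall fun y => ?_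
    obtain ⟨t, ht, hty⟩ := habs y
    obtain ⟨n, hn⟩ := exists_nat_one_div_lt ht
    refine Set.mem_iUnion.2 ⟨n, ?_⟩
    have hle : ((n : ℝ) + 1)⁻¹ / t ≤ 1 := by
      rw [div_le_one ht, ← one_div]; exact hn.le
    have := hconv.smul_mem_of_zero_mem h0 hty
      (t := ((n : ℝ) + 1)⁻¹ / t) ⟨by positivity, hle⟩
    rwa [smul_smul, div_mul_cancel₀ _ ht.ne'] at this
  obtain ⟨n, w, hw⟩ := nonempty_interior_of_iUnion_of_closed
    (fun n : ℕ => hB.preimage (continuous_const_smul (((n : ℝ) + 1)⁻¹))) hcover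
  have hne : ((n : ℝ) + 1)⁻¹ ≠ 0 := by positivity
  have hw' : ((n : ℝ) + 1)⁻¹ • w ∈ interior B := by
    have hpre := (Homeomorph.smulOfNeZero (((n : ℝ) + 1)⁻¹) hne (α := Y)).preimage_interior B
    have : w ∈ (Homeomorph.smulOfNeZero (((n : ℝ) + 1)⁻¹) hne (α := Y)) ⁻¹' interior B := by
      rw [hpre]; exact hw
    exact this
  generalize ((n : ℝ) + 1)⁻¹ • w = q at hw'
  -- B also contains a positive multiple of -q, so 0 lies strictly between the interior point q and
  -- a point of B.
  obtain ⟨t, ht, htq⟩ := habs (-q)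
  refine hconv.openSegment_interior_self_subset_interior hw' htq ?_
  refine ⟨t / (1 + t), 1 / (1 + t), by positivity, by positivity, by field_simp; ring, ?_⟩
  rw [smul_smul, smul_neg, ← sub_eq_add_neg, ← sub_smul]
  have : t / (1 + t) - 1 / (1 + t) * t = 0 := by ring
  rw [this, zero_smul]

/-- Subdifferentiability of a closed convex value function, given by its epigraph `P`, at a point
of the strong quasi-relative interior of its domain. -/
theorem exists_subgradient_of_cone_closed [CompleteSpace Y] {P : Set (Y × ℝ)} (hP : IsClosed P)
    (hconv : Convex ℝ P) (hup : ∀ y t s, (y, t) ∈ P → t ≤ s → (y, s) ∈ P) {p : ℝ}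
    (hp : ((0 : Y), p) ∈ P) (hmin : ∀ t, ((0 : Y), t) ∈ P → p ≤ t)
    (V : Submodule ℝ Y) (hV : IsClosed (V : Set Y)) (hPV : ∀ q ∈ P, q.1 ∈ V)
    (hVP : ∀ y ∈ V, ∃ t : ℝ, 0 < t ∧ ∃ s, (t • y, s) ∈ P) :
    ∃ w : StrongDual ℝ Y, ∀ q ∈ P, p + w q.1 ≤ q.2 := by
  have : CompleteSpace V := hV.completeSpace_coe
  -- A sublevel set at any height above p would do: it is closed, convex and absorbing in V, hence a
  -- neighbourhood of 0 there.
  set B : Set V := {y | ((y : Y), p + 1) ∈ P} with hBdef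
  have hBc : IsClosed B := hP.preimage (by fun_prop : Continuous fun y : V => ((y : Y), p + 1))
  have hBconv : Convex ℝ B := by
    intro y hy y' hy' a b ha hb hab
    have := hconv hy hy' ha hb hab
    simp only [Prod.smul_mk, Prod.mk_add_mk, smul_eq_mul] at this
    rw [← add_mul, hab, one_mul] at this
    simpa [hBdef] using this
  have hBabs : ∀ y : V, ∃ t : ℝ, 0 < t ∧ t • y ∈ B := by
    intro y
    obtain ⟨t, ht, s, hs⟩ := hVP y y.2
    -- Moving from (0, p) towards (t • y, s) by the fraction k raises the height by k(s - p) ≤ 1.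
    set k : ℝ := 1 / (1 + |s - p|) with hk
    have hk0 : 0 < k := by positivity
    have hk1 : k ≤ 1 := by
      rw [hk, div_le_one (by positivity)]; linarith [abs_nonneg (s - p)]
    refine ⟨k * t, by positivity, ?_⟩
    have := hconv hp hs (sub_nonneg.2 hk1) hk0.le (by ring)
    simp only [Prod.smul_mk, Prod.mk_add_mk, smul_eq_mul, smul_zero, zero_add, smul_smul] at this
    refine hup _ _ _ this ?_
    have h1 : k * (s - p) ≤ 1 := by
      rw [hk, one_div_mul_eq_div, div_le_one (by positivity)]
      linarith [le_abs_self (s - p)]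
    nlinarith
  have h0B := zero_mem_interior_of_absorbing hBc hBconv hBabs
  set Q : Set (V × ℝ) := {q | ((q.1 : Y), q.2) ∈ P} with hQdef
  have hQconv : Convex ℝ Q := by
    intro q hq q' hq' a b ha hb hab
    simpa [hQdef] using hconv hq hq' ha hb hab
  -- The epigraph has an interior point straight above the boundary point (0, p). A hyperplane
  -- separating (0, p) from the interior is therefore not vertical, so it can be normalized to a
  -- slope.
  have hQint : ((0 : V), p + 2) ∈ interior Q := by
    rw [mem_interior_iff_mem_nhds] at h0B ⊢
    rw [nhds_prod_eq]
    filter_upwards [prod_mem_prod h0B (Ioi_mem_nhds (by linarith : p + 1 < p + 2))] with q hq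
    exact hup _ _ _ hq.1 (le_of_lt hq.2)
  have hQnot : ((0 : V), p) ∉ interior Q := by
    intro h
    rw [mem_interior_iff_mem_nhds] at h
    have hc : Tendsto (fun t : ℝ => ((0 : V), t)) (𝓝[<] p) (𝓝 ((0 : V), p)) :=
      ((by fun_prop : Continuous fun t : ℝ => ((0 : V), t)).tendsto p).mono_left
        nhdsWithin_le_nhds
    obtain ⟨t, ht, htp⟩ := ((hc.eventually_mem h).and self_mem_nhdsWithin).exists
    have := hmin t (by simpa [hQdef] using ht)
    exact absurd htp (not_lt.2 this)
  obtain ⟨F, hF⟩ := geometric_hahn_banach_open_point hQconv.interior isOpen_interior hQnot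
  have hFle : ∀ q ∈ Q, F q ≤ F (0, p) := by
    intro q hq
    have hsub : closure (interior Q) ⊆ {q | F q ≤ F (0, p)} :=
      closure_minimal (fun q hq => (hF q hq).le) (isClosed_le F.continuous continuous_const)
    refine hsub ?_
    rw [hQconv.closure_interior_eq_closure_of_nonempty_interior ⟨_, hQint⟩]
    exact subset_closure hq
  have hdecomp : ∀ (y : V) (t : ℝ), F (y, t) = F (y, 0) + t * F (0, 1) := by
    intro y t
    have : ((y, t) : V × ℝ) = (y, 0) + t • (0, 1) := by simp
    rw [this, map_add, map_smul, smul_eq_mul]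
  set e := F ((0 : V), (1 : ℝ)) with he
  have hF0 : F ((0 : V), (0 : ℝ)) = 0 := map_zero F
  have he0 : e < 0 := by
    have := hF _ hQint
    rw [hdecomp 0 (p + 2), hdecomp 0 p, hF0] at this
    linarith
  -- The slope is known only on V. Any continuous extension to Y works, since P lies over V.
  set w₀ : StrongDual ℝ V := (-e)⁻¹ • F.comp (ContinuousLinearMap.inl ℝ V ℝ) with hw₀
  obtain ⟨w, hw, -⟩ := exists_extension_norm_eq V w₀
  refine ⟨w, fun q hq => ?_⟩
  have hq' : ((⟨q.1, hPV q hq⟩ : V), q.2) ∈ Q := hq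
  have h1 := hFle _ hq'
  rw [hdecomp _ q.2, hdecomp 0 p, hF0] at h1
  have h2 : w q.1 = (-e)⁻¹ * F (⟨q.1, hPV q hq⟩, 0) := by
    have := hw ⟨q.1, hPV q hq⟩
    simpa [hw₀] using this
  rw [h2, inv_mul_eq_div, ← le_sub_iff_add_le', div_le_iff₀ (by linarith)]
  linarith

end ValueFunction

/-! ### Extended real arithmetic -/

section ExtendedReal

theorem add_coe_le_coe_iff (a : EReal) (r s : ℝ) :
    a + (r : EReal) ≤ (s : EReal) ↔ a ≤ ((s - r : ℝ) : EReal) := by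
  induction a with
  | bot => simp
  | top => simp only [EReal.top_add_coe, top_le_iff, EReal.coe_ne_top]
  | coe a => norm_cast; exact le_sub_iff_add_le.symm

theorem sub_coe_le_coe_iff (a : EReal) (r s : ℝ) :
    a - (r : EReal) ≤ (s : EReal) ↔ a ≤ ((s + r : ℝ) : EReal) := by
  rw [sub_eq_add_neg, ← EReal.coe_neg, add_coe_le_coe_iff, sub_neg_eq_add]

theorem exists_coe_eq {a : EReal} (h : a ≠ ⊥) (h' : a ≠ ⊤) : ∃ r : ℝ, a = r :=
  ⟨a.toReal, (EReal.coe_toReal h' h).symm⟩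

theorem exists_coe_eq_of_le {a : EReal} {t : ℝ} (h : a ≠ ⊥) (h' : a ≤ t) : ∃ r : ℝ, a = r :=
  exists_coe_eq h (h'.trans_lt (EReal.coe_lt_top t)).ne

/-- Testing against real upper bounds turns inequalities between extended reals into real ones; the
value ⊤ then needs no separate case. -/
theorem le_of_forall_coe_ge {a b : EReal} (h : ∀ t : ℝ, b ≤ t → a ≤ t) : a ≤ b :=
  EReal.le_of_forall_lt_iff_le.1 fun z hz => h z hz.le

theorem continuousAt_add_of_ne_bot {a b : EReal} (ha : a ≠ ⊥) (hb : b ≠ ⊥) :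
    ContinuousAt (fun p : EReal × EReal => p.1 + p.2) (a, b) :=
  EReal.continuousAt_add (Or.inr hb) (Or.inl ha)

theorem lowerSemicontinuous_add_of_ne_bot {X : Type*} [TopologicalSpace X] {f g : X → EReal}
    (hf : LowerSemicontinuous f) (hg : LowerSemicontinuous g) (hf' : ∀ x, f x ≠ ⊥)
    (hg' : ∀ x, g x ≠ ⊥) : LowerSemicontinuous fun x => f x + g x :=
  hf.add' hg fun x => continuousAt_add_of_ne_bot (hf' x) (hg' x)

theorem lowerSemicontinuous_add_coe {X : Type*} [TopologicalSpace X] {f : X → EReal}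
    (hf : LowerSemicontinuous f) (hf' : ∀ x, f x ≠ ⊥) {u : X → ℝ} (hu : Continuous u) :
    LowerSemicontinuous fun x => f x + (u x : EReal) :=
  lowerSemicontinuous_add_of_ne_bot hf (continuous_coe_real_ereal.comp hu).lowerSemicontinuous hf'
    fun _ => EReal.coe_ne_bot _

theorem sum_ne_bot {ι : Type*} {s : Finset ι} {a : ι → EReal} (h : ∀ i, a i ≠ ⊥) :
    ∑ i ∈ s, a i ≠ ⊥ := by
  classical
  induction s using Finset.induction_on with
  | empty => simp
  | insert i s hi IH => rw [Finset.sum_insert hi]; exact EReal.add_ne_bot_iff.2 ⟨h i, IH⟩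

theorem lowerSemicontinuous_sum_of_ne_bot {X ι : Type*} [TopologicalSpace X] {s : Finset ι}
    {f : ι → X → EReal} (hf : ∀ i, LowerSemicontinuous (f i)) (hf' : ∀ i x, f i x ≠ ⊥) :
    LowerSemicontinuous fun x => ∑ i ∈ s, f i x := by
  classical
  induction s using Finset.induction_on with
  | empty => simpa using lowerSemicontinuous_const
  | insert i s hi IH =>
    simp only [Finset.sum_insert hi]
    exact lowerSemicontinuous_add_of_ne_bot (hf i) IH (hf' i) fun x => sum_ne_bot fun j => hf' j x

theorem ne_top_of_sum_ne_top {ι : Type*} {s : Finset ι} {a : ι → EReal} (h : ∀ i, a i ≠ ⊥)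
    (hs : ∑ i ∈ s, a i ≠ ⊤) : ∀ i ∈ s, a i ≠ ⊤ := by
  classical
  intro i hi
  rw [← Finset.add_sum_erase s a hi] at hs
  exact ((EReal.add_ne_top_iff_ne_top₂ (h i) (sum_ne_bot h)).1 hs).1

theorem coe_sum_real {ι : Type*} (s : Finset ι) (a : ι → ℝ) :
    ∑ i ∈ s, (a i : EReal) = ((∑ i ∈ s, a i : ℝ) : EReal) :=
  (map_sum (⟨⟨Real.toEReal, rfl⟩, EReal.coe_add⟩ : ℝ →+ EReal) a s).symm

theorem isClosed_epigraph_real {X : Type*} [TopologicalSpace X] {f : X → EReal}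
    (hf : LowerSemicontinuous f) : IsClosed {p : X × ℝ | f p.1 ≤ (p.2 : EReal)} :=
  hf.isClosed_epigraph.preimage
    (continuous_fst.prodMk (continuous_coe_real_ereal.comp continuous_snd))

end ExtendedReal

/-! ### Derivatives from one-sided difference quotients -/

section Slope

/-- A one-sided bound on difference quotients bounds the derivative. -/
theorem deriv_le_of_forall_sub_le {φ : ℝ → ℝ} {d c : ℝ} (hφ : HasDerivAt φ d 0)
    (h : ∀ s, 0 < s → s < 1 → φ s - φ 0 ≤ s * c) : d ≤ c := by
  have ht := (hasDerivAt_iff_tendsto_slope_zero.1 hφ).mono_left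
    (nhdsWithin_mono _ (fun x hx => (ne_of_gt hx : x ≠ 0)) : 𝓝[>] (0 : ℝ) ≤ _)
  refine le_of_tendsto ht ?_
  filter_upwards [Ioo_mem_nhdsGT (zero_lt_one' ℝ)] with s hs
  rw [zero_add, smul_eq_mul, inv_mul_le_iff₀ hs.1]
  exact h s hs.1 hs.2

end Slope

/-! ### Convexity, subgradients, conjugates and proximal points -/

section Inner

variable {H : Type*} [NormedAddCommGroup H] [InnerProductSpace ℝ H]

theorem norm_combo_sq (x y : H) {a b : ℝ} (hab : a + b = 1) :
    ‖a • x + b • y‖ ^ 2 = a * ‖x‖ ^ 2 + b * ‖y‖ ^ 2 - a * b * ‖x - y‖ ^ 2 := by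
  rw [norm_add_sq_real, norm_sub_sq_real, norm_smul, norm_smul, mul_pow, mul_pow,
    Real.norm_eq_abs, Real.norm_eq_abs, sq_abs, sq_abs, inner_smul_left, inner_smul_right]
  obtain rfl : b = 1 - a := by linarith
  simp
  ring

theorem IsConvex.combo_le {f : H → EReal} (hf : IsConvex f) {x y : H} {s t a b : ℝ}
    (hx : f x ≤ s) (hy : f y ≤ t) (ha : 0 ≤ a) (hb : 0 ≤ b) (hab : a + b = 1) :
    f (a • x + b • y) ≤ ((a * s + b * t : ℝ) : EReal) :=
  hf (show (x, s) ∈ {p : H × ℝ | f p.1 ≤ (p.2 : EReal)} from hx)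
    (show (y, t) ∈ {p : H × ℝ | f p.1 ≤ (p.2 : EReal)} from hy) ha hb hab

theorem IsStronglyConvex.combo_le {γ : ℝ} {f : H → EReal} (hf : IsStronglyConvex γ f) {x y : H}
    {s t a b : ℝ} (hx : f x ≤ s) (hy : f y ≤ t) (ha : 0 ≤ a) (hb : 0 ≤ b) (hab : a + b = 1) :
    f (a • x + b • y) ≤ ((a * s + b * t - γ / 2 * (a * b) * ‖x - y‖ ^ 2 : ℝ) : EReal) := by
  have h1 := IsConvex.combo_le (f := fun x => f x - ((γ / 2 * ‖x‖ ^ 2 : ℝ) : EReal)) hf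
    (x := x) (y := y) (s := s - γ / 2 * ‖x‖ ^ 2) (t := t - γ / 2 * ‖y‖ ^ 2)
    ((sub_coe_le_coe_iff _ _ _).2 (by simpa using hx))
    ((sub_coe_le_coe_iff _ _ _).2 (by simpa using hy)) ha hb hab
  rw [sub_coe_le_coe_iff, norm_combo_sq x y hab] at h1
  convert h1 using 2
  ring

theorem mem_subdiff_iff {f : H → EReal} {x v : H} {a : ℝ} (hx : f x = a) :
    v ∈ subdiff f x ↔ ∀ (y : H) (t : ℝ), f y ≤ t → a + inner ℝ v (y - x) ≤ t := by
  constructor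
  · rintro ⟨-, -, h⟩ y t hy
    have := (h y).trans hy
    rw [hx] at this
    exact_mod_cast this
  · intro h
    refine ⟨by simp [hx], by simp [hx], fun y => le_of_forall_coe_ge fun t ht => ?_⟩
    rw [hx]
    exact_mod_cast h y t ht

theorem exists_coe_eq_of_mem_subdiff {f : H → EReal} {x v : H} (h : v ∈ subdiff f x) :
    ∃ a : ℝ, f x = a :=
  exists_coe_eq h.2.1 h.1

/-- Monotonicity of the subdifferential. -/
theorem subdiff_monotone {f : H → EReal} {x y u v : H} (hu : u ∈ subdiff f x)
    (hv : v ∈ subdiff f y) : 0 ≤ inner ℝ (u - v) (x - y) := by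
  obtain ⟨a, ha⟩ := exists_coe_eq_of_mem_subdiff hu
  obtain ⟨b, hb⟩ := exists_coe_eq_of_mem_subdiff hv
  have h1 := (mem_subdiff_iff ha).1 hu y b hb.le
  have h2 := (mem_subdiff_iff hb).1 hv x a ha.le
  rw [← neg_sub x y, inner_neg_right] at h1
  rw [inner_sub_left]
  linarith

/-- Apply the subgradient inequality at (1 - s)x + sy, bound the value there by strong convexity,
divide by s and let s → 0: the factor s(1 - s) leaves the full constant γ/2. -/
theorem IsStronglyConvex.subdiff_le {γ : ℝ} {f : H → EReal} (hf : IsStronglyConvex γ f)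
    {x u : H} {a : ℝ} (hx : f x = a) (hu : u ∈ subdiff f x) {y : H} {t : ℝ} (hy : f y ≤ t) :
    a + inner ℝ u (y - x) + γ / 2 * ‖y - x‖ ^ 2 ≤ t := by
  have hd : HasDerivAt (fun s : ℝ => s * (a + inner ℝ u (y - x))
      + γ / 2 * (s * (1 - s)) * ‖y - x‖ ^ 2 - s * a)
      (a + inner ℝ u (y - x) + γ / 2 * ‖y - x‖ ^ 2 - a) 0 := by
    have h1 := ((hasDerivAt_id (0 : ℝ)).mul_const (a + inner ℝ u (y - x)))
    have h2 := (((hasDerivAt_id (0 : ℝ)).mul ((hasDerivAt_id (0 : ℝ)).const_sub 1)).const_mul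
      (γ / 2)).mul_const (‖y - x‖ ^ 2)
    have h3 := ((hasDerivAt_id (0 : ℝ)).mul_const a)
    refine ((h1.add h2).sub h3).congr_deriv ?_
    simp
  have := deriv_le_of_forall_sub_le (c := t - a) hd ?_
  · linarith
  intro s hs hs1
  have h1 := hf.combo_le hx.le hy (sub_nonneg.2 hs1.le) hs.le (by ring)
  have h2 := (mem_subdiff_iff hx).1 hu _ _ h1
  have h3 : (1 - s) • x + s • y - x = s • (y - x) := by module
  rw [h3, inner_smul_right, norm_sub_rev x y] at h2
  simp only [zero_mul, mul_zero]
  nlinarith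

theorem IsStronglyConvex.subdiff_monotone {γ : ℝ} {f : H → EReal} (hf : IsStronglyConvex γ f)
    {x y u v : H} (hu : u ∈ subdiff f x) (hv : v ∈ subdiff f y) :
    γ * ‖x - y‖ ^ 2 ≤ inner ℝ (u - v) (x - y) := by
  obtain ⟨a, ha⟩ := exists_coe_eq_of_mem_subdiff hu
  obtain ⟨b, hb⟩ := exists_coe_eq_of_mem_subdiff hv
  have h1 := hf.subdiff_le ha hu hb.le
  have h2 := hf.subdiff_le hb hv ha.le
  rw [← neg_sub x y, inner_neg_right, norm_neg] at h1
  rw [inner_sub_left]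
  linarith

/-- The Fenchel–Young equality. -/
theorem conj_eq_of_mem_subdiff {f : H → EReal} {x v : H} {a : ℝ} (hx : f x = a)
    (hv : v ∈ subdiff f x) : conj f v = ((inner ℝ v x - a : ℝ) : EReal) := by
  refine le_antisymm (iSup_le fun y => ?_) ?_
  · induction hy : f y with
    | bot =>
      have := (mem_subdiff_iff hx).1 hv y (a + inner ℝ v (y - x) - 1) (by simp [hy])
      linarith
    | top => simp
    | coe t =>
      have := (mem_subdiff_iff hx).1 hv y t hy.le
      rw [inner_sub_right] at this
      norm_cast
      linarith
  · refine le_trans ?_ (le_iSup _ x)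
    rw [hx]
    norm_cast

theorem conj_le_iff {f : H → EReal} (hf : ∀ x, f x ≠ ⊥) {v : H} {t : ℝ} :
    conj f v ≤ t ↔ ∀ (x : H) (s : ℝ), f x ≤ s → inner ℝ v x - s ≤ t := by
  constructor
  · intro h x s hs
    have h1 : ((inner ℝ v x : ℝ) : EReal) - s ≤ t :=
      (EReal.sub_le_sub le_rfl hs).trans ((le_iSup _ x).trans h)
    exact_mod_cast h1
  · intro h
    refine iSup_le fun x => ?_
    induction hx : f x with
    | bot => exact absurd hx (hf x)
    | top => simp
    | coe s => exact_mod_cast h x s hx.le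

/-- The easy half of Fenchel inversion, from Fenchel–Young. It recasts the dual optimality condition
in terms of gᵢ*, whose proximal map the algorithm uses. -/
theorem mem_subdiff_conj {f : H → EReal} (hf : ∀ x, f x ≠ ⊥) {x v : H} (hv : v ∈ subdiff f x) :
    x ∈ subdiff (conj f) v := by
  obtain ⟨a, ha⟩ := exists_coe_eq_of_mem_subdiff hv
  rw [mem_subdiff_iff (conj_eq_of_mem_subdiff ha hv)]
  intro w t ht
  have := (conj_le_iff hf).1 ht x a ha.le
  rw [inner_sub_right, real_inner_comm w x, real_inner_comm v x]
  linarith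

theorem conj_ne_bot {f : H → EReal} (hf : (dom f).Nonempty) (v : H) : conj f v ≠ ⊥ := by
  obtain ⟨x, hx⟩ := hf
  intro h
  have h1 : ((inner ℝ v x : ℝ) : EReal) - f x ≤ ⊥ :=
    (le_iSup (fun x => ((inner ℝ v x : ℝ) : EReal) - f x) x).trans_eq h
  change f x < ⊤ at hx
  induction hfx : f x with
  | bot => simp [hfx] at h1
  | top => simp [hfx] at hx
  | coe s =>
    rw [hfx, ← EReal.coe_sub, le_bot_iff] at h1
    exact EReal.coe_ne_bot _ h1

theorem isConvex_conj {f : H → EReal} (hf : ∀ x, f x ≠ ⊥) : IsConvex (conj f) := by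
  rintro ⟨v, s⟩ hv ⟨w, t⟩ hw a b ha hb hab
  simp only [Set.mem_ofPred_eq] at hv hw
  rw [conj_le_iff hf] at hv hw
  simp only [Set.mem_ofPred_eq, Prod.smul_mk, Prod.mk_add_mk, smul_eq_mul]
  rw [conj_le_iff hf]
  intro x r hr
  have h1 := mul_le_mul_of_nonneg_left (hv x r hr) ha
  have h2 := mul_le_mul_of_nonneg_left (hw x r hr) hb
  rw [inner_add_left, inner_smul_left, inner_smul_left]
  simp only [conj_trivial]
  have : r = a * r + b * r := by rw [← add_mul, hab, one_mul]
  linarith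

theorem lowerSemicontinuous_conj (f : H → EReal) : LowerSemicontinuous (conj f) := by
  refine lowerSemicontinuous_iSup fun x => ?_
  induction hx : f x with
  | bot =>
    simpa using (lowerSemicontinuous_const : LowerSemicontinuous fun _ : H => (⊤ : EReal))
  | top =>
    simpa using (lowerSemicontinuous_const : LowerSemicontinuous fun _ : H => (⊥ : EReal))
  | coe s =>
    have : Continuous fun v : H => ((inner ℝ v x - s : ℝ) : EReal) :=
      continuous_coe_real_ereal.comp (by fun_prop)
    simpa only [EReal.coe_sub] using this.lowerSemicontinuous

/-- A proper convex lower semicontinuous function has an affine minorant. -/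
theorem exists_affine_minorant {f : H → EReal} (hf : IsGamma f) :
    ∃ (l : StrongDual ℝ H) (c : ℝ), ∀ (x : H) (t : ℝ), f x ≤ t → l x + c ≤ t := by
  obtain ⟨x₀, hx₀⟩ := hf.proper.1
  obtain ⟨a, ha⟩ := exists_coe_eq (hf.proper.2 x₀) (ne_of_lt hx₀)
  -- This point lies directly below the point (x₀, a) of the epigraph, so a strictly separating
  -- hyperplane cannot be vertical.
  have hnot : (x₀, a - 1) ∉ {p : H × ℝ | f p.1 ≤ (p.2 : EReal)} := by
    simp only [Set.mem_ofPred_eq, ha]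
    norm_cast
    simp
  obtain ⟨F, u, hF, hFu⟩ :=
    geometric_hahn_banach_point_closed hf.convex (isClosed_epigraph_real hf.lsc) hnot
  have hdecomp : ∀ (y : H) (t : ℝ), F (y, t) = F (y, 0) + t * F (0, 1) := by
    intro y t
    have : ((y, t) : H × ℝ) = (y, 0) + t • (0, 1) := by simp
    rw [this, map_add, map_smul, smul_eq_mul]
  have h0 := hFu (x₀, a) ha.le
  rw [hdecomp] at hF h0
  set e := F ((0 : H), (1 : ℝ))
  have he : 0 < e := by linarith
  refine ⟨-(e⁻¹ • F.comp (ContinuousLinearMap.inl ℝ H ℝ)), u / e, fun x t hx => ?_⟩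
  have h1 := hFu (x, t) hx
  rw [hdecomp] at h1
  have : -(e⁻¹ * F (x, 0)) + u / e = (u - F (x, 0)) / e := by ring
  simp only [neg_apply, smul_apply,
    ContinuousLinearMap.comp_apply, ContinuousLinearMap.inl_apply, smul_eq_mul]
  rw [this, div_le_iff₀ he]
  linarith

theorem linear_add_sq_bounded_below (l : StrongDual ℝ H) {κ : ℝ} (hκ : 0 < κ) (x : H) :
    -(‖l‖ ^ 2 / (4 * κ)) ≤ l x + κ * ‖x‖ ^ 2 := by
  have h1 : -(‖l‖ * ‖x‖) ≤ l x := (abs_le.1 (l.le_opNorm x)).1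
  have h3 : ‖l‖ ^ 2 / (4 * κ) = (‖l‖ - 2 * κ * ‖x‖) ^ 2 / (4 * κ) + ‖l‖ * ‖x‖ - κ * ‖x‖ ^ 2 := by
    field_simp; ring
  have h4 : 0 ≤ (‖l‖ - 2 * κ * ‖x‖) ^ 2 / (4 * κ) := by positivity
  linarith

variable [CompleteSpace H]

/-- The slope of an affine minorant of f is a point where the conjugate is finite; this supplies the
nonempty domain. -/
theorem isGamma_conj {f : H → EReal} (hf : IsGamma f) : IsGamma (conj f) where
  proper := by
    refine ⟨?_, conj_ne_bot hf.proper.1⟩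
    obtain ⟨l, c, hl⟩ := exists_affine_minorant hf
    refine ⟨(InnerProductSpace.toDual ℝ H).symm l, lt_of_le_of_lt ?_ (EReal.coe_lt_top (-c))⟩
    rw [conj_le_iff hf.proper.2]
    intro x s hs
    rw [InnerProductSpace.toDual_symm_apply]
    linarith [hl x s hs]
  convex := isConvex_conj hf.proper.2
  lsc := lowerSemicontinuous_conj f

theorem hasDerivAt_line {h : H → ℝ} {k x : H} (hk : HasGradientAt h k x) (d : H) :
    HasDerivAt (fun s : ℝ => h (x + s • d)) (inner ℝ k d) 0 := by
  have h1 : HasDerivAt (fun s : ℝ => x + s • d) d 0 := by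
    simpa using ((hasDerivAt_id (0 : ℝ)).smul_const d).const_add x
  have h2 : HasFDerivAt h (InnerProductSpace.toDual ℝ H k) (x + (0 : ℝ) • d) := by
    simpa using hk.hasFDerivAt
  exact h2.comp_hasDerivAt (0 : ℝ) h1

theorem gradient_inequality {h : H → ℝ} (hc : ConvexOn ℝ Set.univ h) {k x : H}
    (hk : HasGradientAt h k x) (y : H) : h x + inner ℝ k (y - x) ≤ h y := by
  have := deriv_le_of_forall_sub_le (c := h y - h x) (hasDerivAt_line hk (y - x)) ?_
  · linarith
  intro s hs hs1
  have h1 := hc.2 (Set.mem_univ x) (Set.mem_univ y) (sub_nonneg.2 hs1.le) hs.le (by ring)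
  have h2 : (1 - s) • x + s • y = x + s • (y - x) := by module
  rw [h2] at h1
  simp only [smul_eq_mul] at h1
  rw [zero_smul, add_zero]
  linarith

/-- The smooth part of a subgradient of a sum can be split off. -/
theorem sub_mem_subdiff {f : H → EReal} (hf : IsConvex f) {h : H → ℝ} {k x u : H} {a : ℝ}
    (hx : f x = a) (hk : HasGradientAt h k x)
    (hu : ∀ (y : H) (t : ℝ), f y ≤ t → a + h x + inner ℝ u (y - x) ≤ t + h y) :
    u - k ∈ subdiff f x := by
  rw [mem_subdiff_iff hx]
  intro y t hy
  have := deriv_le_of_forall_sub_le (φ := fun s : ℝ => -h (x + s • (y - x)))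
    (c := t - a - inner ℝ u (y - x)) (hasDerivAt_line hk (y - x)).neg ?_
  · rw [inner_sub_left]
    linarith
  intro s hs hs1
  have h1 := hu _ _ (hf.combo_le hx.le hy (sub_nonneg.2 hs1.le) hs.le (by ring))
  have h2 : (1 - s) • x + s • y = x + s • (y - x) := by module
  rw [h2, add_sub_cancel_left, inner_smul_right] at h1
  rw [zero_smul, add_zero]
  linarith

/-- The projection theorem again, with an idle parameter space ℝ: the heights above the prox
objective form a closed set bounded below, so the infimum is attained. -/
theorem exists_isProxPoint {f : H → EReal} (hf : IsGamma f) {t : ℝ} (ht : 0 < t) (x : H) :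
    ∃ p, IsProxPoint t f x p := by
  set κ : ℝ := 1 / (2 * t) with hκ
  have hκ0 : 0 < κ := by positivity
  set Φ : H → EReal := fun y => f y + ((κ * ‖y - x‖ ^ 2 : ℝ) : EReal) with hΦ
  have hΦlsc : LowerSemicontinuous Φ :=
    lowerSemicontinuous_add_coe hf.lsc hf.proper.2 (by fun_prop)
  have hΦle : ∀ (y : H) (s : ℝ), Φ y ≤ s ↔ f y ≤ ((s - κ * ‖y - x‖ ^ 2 : ℝ) : EReal) :=
    fun y s => add_coe_le_coe_iff _ _ _
  set E : Set (H × ℝ × ℝ) := {p | Φ p.1 ≤ (p.2.2 : EReal)} with hE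
  have hEc : IsClosed E := (isClosed_epigraph_real hΦlsc).preimage
    (by fun_prop : Continuous fun p : H × ℝ × ℝ => (p.1, p.2.2))
  obtain ⟨l, c, hl⟩ := exists_affine_minorant hf
  have hbound : ∀ p ∈ E, -(‖l‖ ^ 2 / (4 * κ)) + l x + c ≤ p.2.2 := by
    intro p hp
    have h1 := hl _ _ ((hΦle _ _).1 hp)
    have h2 := linear_add_sq_bounded_below l hκ0 (p.1 - x)
    rw [map_sub] at h2
    linarith
  -- κ/4 is the midpoint gain of κ‖· - x‖².
  have hclosed := isClosed_image_snd_of_uniformlyConvex hEc (κ := κ / 4) (by positivity)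
    (by
      intro p hp q hq
      have h1 := (hΦle _ _).1 hp
      have h2 := (hΦle _ _).1 hq
      have h3 := hf.convex.combo_le h1 h2 (a := 1 / 2) (b := 1 / 2) (by norm_num) (by norm_num)
        (by norm_num)
      refine (hΦle _ _).2 (h3.trans (EReal.coe_le_coe_iff.2 (le_of_eq ?_)))
      have h4 : (1 / 2 : ℝ) • p.1 + (1 / 2 : ℝ) • q.1 - x =
        (1 / 2 : ℝ) • (p.1 - x) + (1 / 2 : ℝ) • (q.1 - x) := by module
      simp only [h4]
      rw [norm_combo_sq (a := 1 / 2) (b := 1 / 2) _ _ (by norm_num), sub_sub_sub_cancel_right]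
      ring)
    (by
      intro y u s s' h1 h2
      exact le_trans (show Φ y ≤ (s : EReal) from h1) (EReal.coe_le_coe_iff.2 h2))
    (b := fun _ => -(‖l‖ ^ 2 / (4 * κ)) + l x + c) continuous_const hbound
  set T : Set ℝ := {s | ((0 : ℝ), s) ∈ Prod.snd '' E} with hT
  have hTc : IsClosed T := hclosed.preimage (by fun_prop : Continuous fun s : ℝ => ((0 : ℝ), s))
  have hTmem : ∀ (y : H) (s : ℝ), Φ y ≤ s → s ∈ T := fun y s hs => ⟨(y, 0, s), hs, rfl⟩
  have hTb : BddBelow T := by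
    refine ⟨-(‖l‖ ^ 2 / (4 * κ)) + l x + c, ?_⟩
    rintro s ⟨p, hp, hps⟩
    have := hbound p hp
    rwa [hps] at this
  have hTn : T.Nonempty := by
    obtain ⟨x₀, hx₀⟩ := hf.proper.1
    obtain ⟨a, ha⟩ := exists_coe_eq (hf.proper.2 x₀) (ne_of_lt hx₀)
    exact ⟨a + κ * ‖x₀ - x‖ ^ 2, hTmem x₀ _ ((hΦle _ _).2 (by simp [ha]))⟩
  obtain ⟨⟨p, u, s⟩, hp, hps⟩ := hTc.csInf_mem hTn hTb
  obtain ⟨-, rfl⟩ := Prod.mk.inj hps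
  refine ⟨p, fun y _ => le_of_forall_coe_ge fun s hs => ?_⟩
  exact le_trans (show Φ p ≤ _ from hp) (EReal.coe_le_coe_iff.2 (csInf_le hTb (hTmem y s hs)))

theorem IsProxPoint.mem_subdiff {f : H → EReal} (hf : IsGamma f) {t : ℝ} (ht : 0 < t) {x p : H}
    (hp : IsProxPoint t f x p) : (1 / t) • (x - p) ∈ subdiff f p := by
  have hmin : ∀ (y : H) (s : ℝ), f y ≤ s →
      f p ≤ ((s + 1 / (2 * t) * ‖y - x‖ ^ 2 - 1 / (2 * t) * ‖p - x‖ ^ 2 : ℝ) : EReal) := by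
    intro y s hs
    rw [← add_coe_le_coe_iff]
    refine le_trans (hp (Set.mem_univ y)) ?_
    rw [add_coe_le_coe_iff]
    simpa using hs
  obtain ⟨x₀, hx₀⟩ := hf.proper.1
  obtain ⟨b, hb⟩ := exists_coe_eq (hf.proper.2 x₀) (ne_of_lt hx₀)
  obtain ⟨a, ha⟩ := exists_coe_eq_of_le (hf.proper.2 p) (hmin x₀ b hb.le)
  have hk : HasGradientAt (fun y : H => 1 / (2 * t) * ‖y - x‖ ^ 2) ((1 / t) • (p - x)) p := by
    rw [hasGradientAt_iff_hasFDerivAt]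
    have h1 : HasFDerivAt (fun y : H => y - x) (ContinuousLinearMap.id ℝ H) p :=
      (hasFDerivAt_id p).sub_const x
    refine (h1.norm_sq.const_mul (1 / (2 * t))).congr_fderiv ?_
    ext d
    simp
    field_simp
  -- Fermat's rule: 0 is a subgradient of the prox objective at p, and its smooth quadratic part
  -- splits off.
  have := sub_mem_subdiff hf.convex (u := 0) ha hk ?_
  · convert this using 1
    rw [zero_sub, ← smul_neg, neg_sub]
  intro y s hs
  have := hmin y s hs
  rw [ha] at this
  rw [inner_zero_left]
  have := EReal.coe_le_coe_iff.1 this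
  linarith

/-- Every minimizer satisfies the inclusion, so existence alone is enough for the point chosen by
`Classical.epsilon`. -/
theorem prox_mem_subdiff {f : H → EReal} (hf : IsGamma f) {t : ℝ} (ht : 0 < t) (x : H) :
    (1 / t) • (x - prox t f x) ∈ subdiff f (prox t f x) :=
  IsProxPoint.mem_subdiff hf ht (Classical.epsilon_spec (exists_isProxPoint hf ht x))

end Inner

/-! ### Young's inequality and smooth perturbations of subgradients -/

section Smooth

theorem two_mul_inner_le {H E : Type*} [NormedAddCommGroup H] [InnerProductSpace ℝ H]
    [NormedAddCommGroup E] [InnerProductSpace ℝ E] {s t : ℝ}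
    (hs : 0 < s) (ht : 0 < t) (T : H →L[ℝ] E) (d : H) (w : E) :
    2 / t * |inner ℝ (T d) w| ≤ ‖w‖ ^ 2 / s + s * ‖T‖ ^ 2 * (‖d‖ ^ 2 / t ^ 2) := by
  have h1 : |inner ℝ (T d) w| ≤ ‖T‖ * ‖d‖ * ‖w‖ :=
    (abs_real_inner_le_norm _ _).trans
      (mul_le_mul_of_nonneg_right (T.le_opNorm d) (norm_nonneg _))
  have h0 := mul_le_mul_of_nonneg_left h1 (by positivity : 0 ≤ 2 / t)
  have h2 : 0 ≤ (‖w‖ - s * ‖T‖ * (‖d‖ / t)) ^ 2 / s := by positivity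
  have h3 : (‖w‖ - s * ‖T‖ * (‖d‖ / t)) ^ 2 / s
      = ‖w‖ ^ 2 / s + s * ‖T‖ ^ 2 * (‖d‖ ^ 2 / t ^ 2) - 2 / t * (‖T‖ * ‖d‖ * ‖w‖) := by
    field_simp; ring
  linarith

variable {H : Type*} [NormedAddCommGroup H] [InnerProductSpace ℝ H] [CompleteSpace H]

theorem add_gradient_mem_subdiff {f : H → EReal} {h : H → ℝ} (hc : ConvexOn ℝ Set.univ h)
    {k x u : H} (hk : HasGradientAt h k x) (hu : u ∈ subdiff f x) :
    u + k ∈ subdiff (fun x => f x + (h x : EReal)) x := by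
  obtain ⟨a, ha⟩ := exists_coe_eq_of_mem_subdiff hu
  have hx : f x + (h x : EReal) = ((a + h x : ℝ) : EReal) := by rw [ha]; norm_cast
  rw [mem_subdiff_iff (f := fun x => f x + (h x : EReal)) hx]
  intro y t ht
  have h1 := (mem_subdiff_iff ha).1 hu y _ ((add_coe_le_coe_iff _ _ _).1 ht)
  have h2 := gradient_inequality hc hk y
  rw [inner_add_left]
  linarith

end Smooth

/-! ### Energy descent along the algorithm -/

section Algorithm

variable {H : Type*} [NormedAddCommGroup H] [InnerProductSpace ℝ H] [CompleteSpace H]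
  {m : ℕ} {G : Fin m → Type*} [∀ i, NormedAddCommGroup (G i)]
  [∀ i, InnerProductSpace ℝ (G i)] [∀ i, CompleteSpace (G i)]
  {z : H} {f : H → EReal} {h : H → ℝ} {r : ∀ i, G i} {g : ∀ i, G i → EReal}
  {L : ∀ i, H →L[ℝ] G i} {γ η lam : ℝ} {τ θ : ℕ → ℝ}
  {σ : ℕ → Fin m → ℝ} {x y : ℕ → H} {v : ℕ → ∀ i, G i}

namespace IsAlgorithm

theorem lam_pos (A : IsAlgorithm z f h r g L γ η lam τ θ σ x y v) (hη : 0 < η) : 0 < lam := by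
  linarith [A.le_lam]

theorem eta_mul_tau_zero_lt (A : IsAlgorithm z f h r g L γ η lam τ θ σ x y v) (hη : 0 < η) :
    η * τ 0 < 2 * γ := by
  have := A.tau_lt
  rwa [lt_div_iff₀ hη, mul_comm] at this

theorem one_lt_radicand (hl : 0 < lam) {t : ℝ} (ht : 0 < t) (htη : η * t < 2 * γ) :
    1 < 1 + t * (2 * γ - η * t) / lam := by
  have : 0 < t * (2 * γ - η * t) / lam := div_pos (mul_pos ht (by linarith)) hl
  linarith

theorem tau_pos_le (A : IsAlgorithm z f h r g L γ η lam τ θ σ x y v) (hη : 0 < η) (n : ℕ) :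
    0 < τ n ∧ τ n ≤ τ 0 := by
  induction n with
  | zero => exact ⟨A.tau_pos, le_rfl⟩
  | succ n ih =>
    have hη' : η * τ n < 2 * γ :=
      (mul_le_mul_of_nonneg_left ih.2 hη.le).trans_lt (A.eta_mul_tau_zero_lt hη)
    have hD := one_lt_radicand (A.lam_pos hη) ih.1 hη'
    have hs : 1 ≤ √(1 + τ n * (2 * γ - η * τ n) / lam) := Real.one_le_sqrt.2 hD.le
    rw [A.tau_succ, A.theta_eq, one_div_mul_eq_div]
    exact ⟨div_pos ih.1 (by linarith), (div_le_self ih.1.le hs).trans ih.2⟩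

theorem tau_pos' (A : IsAlgorithm z f h r g L γ η lam τ θ σ x y v) (hη : 0 < η) (n : ℕ) :
    0 < τ n := (A.tau_pos_le hη n).1

theorem eta_mul_tau_lt (A : IsAlgorithm z f h r g L γ η lam τ θ σ x y v) (hη : 0 < η) (n : ℕ) :
    η * τ n < 2 * γ :=
  (mul_le_mul_of_nonneg_left (A.tau_pos_le hη n).2 hη.le).trans_lt (A.eta_mul_tau_zero_lt hη)

theorem radicand (A : IsAlgorithm z f h r g L γ η lam τ θ σ x y v) (hη : 0 < η) (n : ℕ) :
    1 < 1 + τ n * (2 * γ - η * τ n) / lam :=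
  one_lt_radicand (A.lam_pos hη) (A.tau_pos' hη n) (A.eta_mul_tau_lt hη n)

theorem theta_pos (A : IsAlgorithm z f h r g L γ η lam τ θ σ x y v) (hη : 0 < η) (n : ℕ) :
    0 < θ n := by
  rw [A.theta_eq]
  have := A.radicand hη n
  positivity

/-- The factors θ cancel in the shifted product. This invariant keeps the dual weights in the energy
constant. -/
theorem sigma_mul_tau (A : IsAlgorithm z f h r g L γ η lam τ θ σ x y v) (hη : 0 < η) (n : ℕ)
    (i : Fin m) : σ n i * τ (n + 1) = τ 1 * σ 0 i := by
  induction n with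
  | zero => rw [zero_add, mul_comm]
  | succ n ih =>
    have := (A.theta_pos hη (n + 1)).ne'
    rw [← ih, A.sigma_succ, A.tau_succ (n + 1)]
    field_simp

theorem sigma_pos' (A : IsAlgorithm z f h r g L γ η lam τ θ σ x y v) (hη : 0 < η) (n : ℕ)
    (i : Fin m) : 0 < σ n i := by
  have h1 := A.sigma_mul_tau hη n i
  have h2 : 0 < τ 1 * σ 0 i := mul_pos (A.tau_pos' hη 1) (A.sigma_pos i)
  exact pos_of_mul_pos_left (h1 ▸ h2) (A.tau_pos' hη (n + 1)).le

/-- This identity dictates the formula for θ: the curvature gained in one primal step is precisely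
the increase of the weight λ/τ². -/
theorem div_tau_succ_sq (A : IsAlgorithm z f h r g L γ η lam τ θ σ x y v) (hη : 0 < η) (n : ℕ) :
    lam / τ (n + 1) ^ 2 = (2 * γ - η * τ n) / τ n + lam / τ n ^ 2 := by
  have hD : 0 < 1 + τ n * (2 * γ - η * τ n) / lam := by linarith [A.radicand hη n]
  have hl := A.lam_pos hη
  have ht := A.tau_pos' hη n
  rw [A.tau_succ, A.theta_eq, mul_pow, div_pow, Real.sq_sqrt hD.le]
  rw [one_pow, one_div_mul_eq_div, div_div_eq_mul_div]
  field_simp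
  ring

theorem step_le_one (A : IsAlgorithm z f h r g L γ η lam τ θ σ x y v) (hη : 0 < η) :
    τ 1 * ∑ i, σ 0 i * ‖L i‖ ^ 2 ≤ 1 := by
  have hD := A.radicand hη 0
  have hs : 0 < √(1 + τ 0 * (2 * γ - η * τ 0) / lam) := Real.sqrt_pos.2 (by linarith)
  have := A.step
  rw [← zero_add 1, A.tau_succ, A.theta_eq, mul_assoc, one_div_mul_eq_div]
  rwa [div_le_one hs]

theorem primal_step (A : IsAlgorithm z f h r g L γ η lam τ θ σ x y v) (hf : IsGamma f)
    (h_conv : ConvexOn ℝ Set.univ h) (h_diff : Differentiable ℝ h)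
    (hη : 0 < η) (h_lip : ∀ x y, ‖∇ h x - ∇ h y‖ ≤ η * ‖x - y‖)
    (h_strong : IsStronglyConvex γ (fun x => f x + (h x : EReal))) {xbar : H} {vbar : ∀ i, G i}
    (hoc : OptimalityConditions z f h r g L xbar vbar) (n : ℕ) :
    lam * ‖x (n + 1) - xbar‖ ^ 2 / τ (n + 1) ^ 2 + ‖x (n + 1) - x n‖ ^ 2 / τ n ^ 2
      + 2 / τ n * ∑ i, inner ℝ (L i (x (n + 1) - xbar)) (v n i - vbar i)
      ≤ lam * ‖x n - xbar‖ ^ 2 / τ n ^ 2 := by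
  have hl := A.lam_pos hη
  have ht := A.tau_pos' hη n
  have hgrad : ∀ x, HasGradientAt h (∇ h x) x := fun x => (h_diff x).hasGradientAt
  have hp := prox_mem_subdiff hf (div_pos ht hl)
    (x n - (τ n / lam) • (∑ i, (L i).adjoint (v n i) + ∇ h (x n) - z))
  rw [← A.x_succ n] at hp
  have hp' := add_gradient_mem_subdiff h_conv (hgrad (x (n + 1))) hp
  obtain ⟨u, hu, k, rfl, huk⟩ := Set.mem_add.1 hoc.1
  have hu' := add_gradient_mem_subdiff h_conv (hgrad xbar) hu
  rw [huk] at hu'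
  have hmono := h_strong.subdiff_monotone hp' hu'
  have heq : (1 / (τ n / lam)) • (x n - (τ n / lam) • (∑ i, (L i).adjoint (v n i) + ∇ h (x n) - z)
        - x (n + 1)) + ∇ h (x (n + 1)) - (z - ∑ i, (L i).adjoint (vbar i))
      = (lam / τ n) • (x n - x (n + 1)) + (∇ h (x (n + 1)) - ∇ h (x n))
        - ∑ i, (L i).adjoint (v n i - vbar i) := by
    simp only [map_sub, Finset.sum_sub_distrib]
    rw [one_div_div, smul_sub, smul_sub, smul_smul]
    have : lam / τ n * (τ n / lam) = 1 := by field_simp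
    rw [this, one_smul]
    module
  rw [heq, inner_sub_left, inner_add_left, inner_smul_left, sum_inner] at hmono
  simp only [ContinuousLinearMap.adjoint_inner_left, conj_trivial] at hmono
  have hcomm : ∑ i, inner ℝ (L i (x (n + 1) - xbar)) (v n i - vbar i)
      = ∑ i, inner ℝ (v n i - vbar i) (L i (x (n + 1) - xbar)) :=
    Finset.sum_congr rfl fun i _ => real_inner_comm _ _
  rw [hcomm]
  set S := ∑ i, inner ℝ (v n i - vbar i) (L i (x (n + 1) - xbar))
  have h3pt : 2 * inner ℝ (x n - x (n + 1)) (x (n + 1) - xbar)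
      = ‖x n - xbar‖ ^ 2 - ‖x (n + 1) - x n‖ ^ 2 - ‖x (n + 1) - xbar‖ ^ 2 := by
    have h1 : x n - xbar = (x n - x (n + 1)) + (x (n + 1) - xbar) := by abel
    rw [h1, norm_add_sq_real, norm_sub_rev (x n)]
    ring
  have hlip : inner ℝ (∇ h (x (n + 1)) - ∇ h (x n)) (x (n + 1) - xbar)
      ≤ η * ‖x (n + 1) - x n‖ * ‖x (n + 1) - xbar‖ :=
    (real_inner_le_norm _ _).trans
      (mul_le_mul_of_nonneg_right (h_lip _ _) (norm_nonneg _))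
  set I₁ := inner ℝ (x n - x (n + 1)) (x (n + 1) - xbar)
  set I₂ := inner ℝ (∇ h (x (n + 1)) - ∇ h (x n)) (x (n + 1) - xbar)
  set d := ‖x (n + 1) - x n‖
  set e := ‖x (n + 1) - xbar‖
  set e₀ := ‖x n - xbar‖
  -- The gradient is evaluated at the old iterate. Young with weight τ charges part of this error to
  -- the curvature, leaving 2γ - ητ, and part to the step length.
  have hyoung : 2 * (η * d * e) ≤ η * τ n * e ^ 2 + η / τ n * d ^ 2 := by
    have h1 : 0 ≤ η / τ n * (d - τ n * e) ^ 2 := by positivity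
    have h2 : η / τ n * (d - τ n * e) ^ 2
        = η * τ n * e ^ 2 + η / τ n * d ^ 2 - 2 * (η * d * e) := by
      field_simp; ring
    linarith
  -- Here λ ≥ η + 1 enters: once the gradient error is paid, a full unit of d²/τ remains for the
  -- energy.
  have hηl : η / τ n * d ^ 2 + 1 / τ n * d ^ 2 ≤ lam / τ n * d ^ 2 := by
    rw [← add_mul, ← add_div]
    gcongr
    exact A.le_lam
  have hmain : (2 * γ - η * τ n + lam / τ n) * e ^ 2 + 1 / τ n * d ^ 2 + 2 * S
      ≤ lam / τ n * e₀ ^ 2 := by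
    have h4 : lam / τ n * (2 * I₁) = lam / τ n * (e₀ ^ 2 - d ^ 2 - e ^ 2) := by rw [h3pt]
    nlinarith
  have h5 : lam * e ^ 2 / τ (n + 1) ^ 2 = ((2 * γ - η * τ n) / τ n + lam / τ n ^ 2) * e ^ 2 := by
    rw [← A.div_tau_succ_sq hη n]; ring
  rw [h5]
  have h6 := mul_le_mul_of_nonneg_left hmain (one_div_pos.2 ht).le
  calc _ = 1 / τ n * ((2 * γ - η * τ n + lam / τ n) * e ^ 2 + 1 / τ n * d ^ 2 + 2 * S) := by
        field_simp
    _ ≤ _ := h6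
    _ = _ := by field_simp

theorem dual_step (A : IsAlgorithm z f h r g L γ η lam τ θ σ x y v) (hη : 0 < η)
    (hg : ∀ i, IsGamma (g i)) {xbar : H} {vbar : ∀ i, G i}
    (hoc : OptimalityConditions z f h r g L xbar vbar) (n : ℕ) (i : Fin m) :
    ‖v (n + 1) i - vbar i‖ ^ 2 / (τ 1 * σ 0 i) + ‖v (n + 1) i - v n i‖ ^ 2 / (τ 1 * σ 0 i)
      - 2 / τ (n + 1) * inner ℝ (L i (y n - xbar)) (v (n + 1) i - vbar i)
      ≤ ‖v n i - vbar i‖ ^ 2 / (τ 1 * σ 0 i) := by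
  have hσ := A.sigma_pos' hη n i
  have ht := A.tau_pos' hη (n + 1)
  have hp := prox_mem_subdiff (isGamma_conj (hg i)) hσ (v n i + σ n i • (L i (y n) - r i))
  rw [← A.v_succ n i] at hp
  have hb := mem_subdiff_conj (hg i).proper.2 (hoc.2 i)
  have hmono := subdiff_monotone hp hb
  have heq : (1 / σ n i) • (v n i + σ n i • (L i (y n) - r i) - v (n + 1) i) - (L i xbar - r i)
      = (1 / σ n i) • (v n i - v (n + 1) i) + L i (y n - xbar) := by
    rw [map_sub, smul_sub, smul_add, smul_smul, one_div_mul_cancel hσ.ne', one_smul]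
    module
  rw [heq, inner_add_left, inner_smul_left] at hmono
  simp only [conj_trivial] at hmono
  have h3pt : 2 * inner ℝ (v n i - v (n + 1) i) (v (n + 1) i - vbar i)
      = ‖v n i - vbar i‖ ^ 2 - ‖v (n + 1) i - v n i‖ ^ 2 - ‖v (n + 1) i - vbar i‖ ^ 2 := by
    have h1 : v n i - vbar i = (v n i - v (n + 1) i) + (v (n + 1) i - vbar i) := by abel
    rw [h1, norm_add_sq_real, norm_sub_rev (v n i)]
    ring
  rw [← A.sigma_mul_tau hη n i]
  set I := inner ℝ (L i (y n - xbar)) (v (n + 1) i - vbar i)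
  have h6 := mul_le_mul_of_nonneg_left hmono (by positivity : 0 ≤ 2 / τ (n + 1))
  have h7 : 2 / τ (n + 1) * (1 / σ n i * inner ℝ (v n i - v (n + 1) i) (v (n + 1) i - vbar i) + I)
      = (2 * inner ℝ (v n i - v (n + 1) i) (v (n + 1) i - vbar i)) / (σ n i * τ (n + 1))
        + 2 / τ (n + 1) * I := by
    field_simp
  rw [mul_zero, h7, h3pt, sub_div, sub_div] at h6
  linarith

/-- The Lyapunov function of the algorithm. -/
noncomputable def energy (L : ∀ i, H →L[ℝ] G i) (lam : ℝ) (τ : ℕ → ℝ) (σ : ℕ → Fin m → ℝ)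
    (x : ℕ → H) (v : ℕ → ∀ i, G i) (xbar : H) (vbar : ∀ i, G i) (n : ℕ) : ℝ :=
  lam * ‖x (n + 1) - xbar‖ ^ 2 / τ (n + 1) ^ 2
    + ∑ i, ‖v n i - vbar i‖ ^ 2 / (τ 1 * σ 0 i)
    + ‖x (n + 1) - x n‖ ^ 2 / τ n ^ 2
    + 2 / τ n * ∑ i, inner ℝ (L i (x (n + 1) - x n)) (v n i - vbar i)

/-- Adding the primal step at n + 1 to the dual steps at n cancels the coupling terms containing x̄.
Since θ/τ at n + 1 and n combine to 1/τ at n, the rest telescopes up to the pairing of L(xₙ₊₁ - xₙ)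
with vₙ₊₁ - vₙ. Young absorbs it into the dual increment and ‖xₙ₊₁ - xₙ‖²/τₙ², the latter with total
weight at most 1 by `step_le_one`. -/
theorem energy_succ_le (A : IsAlgorithm z f h r g L γ η lam τ θ σ x y v) (hf : IsGamma f)
    (h_conv : ConvexOn ℝ Set.univ h) (h_diff : Differentiable ℝ h)
    (hη : 0 < η) (h_lip : ∀ x y, ‖∇ h x - ∇ h y‖ ≤ η * ‖x - y‖) (hg : ∀ i, IsGamma (g i))
    (h_strong : IsStronglyConvex γ (fun x => f x + (h x : EReal))) {xbar : H} {vbar : ∀ i, G i}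
    (hoc : OptimalityConditions z f h r g L xbar vbar) (n : ℕ) :
    energy L lam τ σ x v xbar vbar (n + 1) ≤ energy L lam τ σ x v xbar vbar n := by
  have ht := A.tau_pos' hη n
  have ht' := A.tau_pos' hη (n + 1)
  have h1 := A.primal_step hf h_conv h_diff hη h_lip h_strong hoc (n + 1)
  have h2 : ∀ i, ‖v (n + 1) i - vbar i‖ ^ 2 / (τ 1 * σ 0 i)
      + (2 / τ (n + 1) * inner ℝ (L i (x (n + 1 + 1) - x (n + 1))) (v (n + 1) i - vbar i)
        - 2 / τ (n + 1) * inner ℝ (L i (x (n + 1 + 1) - xbar)) (v (n + 1) i - vbar i))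
      ≤ ‖v n i - vbar i‖ ^ 2 / (τ 1 * σ 0 i)
        + 2 / τ n * inner ℝ (L i (x (n + 1) - x n)) (v n i - vbar i)
        + τ 1 * (σ 0 i * ‖L i‖ ^ 2) * (‖x (n + 1) - x n‖ ^ 2 / τ n ^ 2) := by
    intro i
    have h3 := A.dual_step hη hg hoc n i
    have h4 := two_mul_inner_le (mul_pos (A.tau_pos' hη 1) (A.sigma_pos i)) ht (L i)
      (x (n + 1) - x n) (v (n + 1) i - v n i)
    have h5 : y n - xbar = (x (n + 1 + 1) - xbar) - (x (n + 1 + 1) - x (n + 1))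
        + θ n • (x (n + 1) - x n) := by
      rw [A.y_eq]; abel
    rw [h5, map_add, map_sub (L i) (x (n + 1 + 1) - xbar), map_smul, inner_add_left,
      inner_sub_left, inner_smul_left] at h3
    simp only [conj_trivial] at h3
    have h6 : v (n + 1) i - vbar i = (v (n + 1) i - v n i) + (v n i - vbar i) := by abel
    have h7 : inner ℝ (L i (x (n + 1) - x n)) (v (n + 1) i - vbar i)
        = inner ℝ (L i (x (n + 1) - x n)) (v (n + 1) i - v n i)
          + inner ℝ (L i (x (n + 1) - x n)) (v n i - vbar i) := by
      rw [← inner_add_right, ← h6]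
    have h8 : 2 / τ (n + 1) * θ n = 2 / τ n := by
      have := (A.theta_pos hη n).ne'
      rw [A.tau_succ]
      field_simp
    rw [h7] at h3
    have h9 : 2 / τ n * inner ℝ (L i (x (n + 1) - x n)) (v (n + 1) i - v n i)
        ≤ 2 / τ n * |inner ℝ (L i (x (n + 1) - x n)) (v (n + 1) i - v n i)| :=
      mul_le_mul_of_nonneg_left (le_abs_self _) (by positivity)
    rw [← h8] at h9 h4 ⊢
    nlinarith
  have h3 := Finset.sum_le_sum fun i (_ : i ∈ Finset.univ) => h2 i
  rw [Finset.sum_add_distrib, Finset.sum_sub_distrib, Finset.sum_add_distrib,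
    Finset.sum_add_distrib, ← Finset.sum_mul, ← Finset.mul_sum, ← Finset.mul_sum,
    ← Finset.mul_sum, ← Finset.mul_sum] at h3
  have h4 : τ 1 * (∑ i, σ 0 i * ‖L i‖ ^ 2) * (‖x (n + 1) - x n‖ ^ 2 / τ n ^ 2)
      ≤ ‖x (n + 1) - x n‖ ^ 2 / τ n ^ 2 :=
    mul_le_of_le_one_left (by positivity) (A.step_le_one hη)
  unfold energy
  linarith

/-- The distance estimate of the accelerated primal-dual algorithm. -/
theorem estimate (A : IsAlgorithm z f h r g L γ η lam τ θ σ x y v) (hf : IsGamma f)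
    (h_conv : ConvexOn ℝ Set.univ h) (h_diff : Differentiable ℝ h)
    (hη : 0 < η) (h_lip : ∀ x y, ‖∇ h x - ∇ h y‖ ≤ η * ‖x - y‖) (hg : ∀ i, IsGamma (g i))
    (h_strong : IsStronglyConvex γ (fun x => f x + (h x : EReal))) {xbar : H} {vbar : ∀ i, G i}
    (hoc : OptimalityConditions z f h r g L xbar vbar) (n : ℕ) :
    lam * ‖x (n + 1) - xbar‖ ^ 2 / τ (n + 1) ^ 2
        + (1 - τ 1 * ∑ i, σ 0 i * ‖L i‖ ^ 2) * ∑ i, ‖v n i - vbar i‖ ^ 2 / (τ 1 * σ 0 i)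
      ≤ energy L lam τ σ x v xbar vbar 0 := by
  have hmono : energy L lam τ σ x v xbar vbar n ≤ energy L lam τ σ x v xbar vbar 0 :=
    antitone_nat_of_succ_le (A.energy_succ_le hf h_conv h_diff hη h_lip hg h_strong hoc)
      (Nat.zero_le n)
  refine le_trans ?_ hmono
  unfold energy
  have ht := A.tau_pos' hη n
  have ht1 := A.tau_pos' hη 1
  set d := ‖x (n + 1) - x n‖ with hd
  set W := ∑ i, ‖v n i - vbar i‖ ^ 2 / (τ 1 * σ 0 i) with hW
  set c := τ 1 * ∑ i, σ 0 i * ‖L i‖ ^ 2 with hc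
  set S := ∑ i, inner ℝ (L i (x (n + 1) - x n)) (v n i - vbar i) with hS
  have hσ : ∀ i, 0 < τ 1 * σ 0 i := fun i => mul_pos ht1 (A.sigma_pos i)
  have hc0 : 0 ≤ c := mul_nonneg ht1.le
    (Finset.sum_nonneg fun i _ => mul_nonneg (A.sigma_pos i).le (sq_nonneg _))
  have hW0 : 0 ≤ W := Finset.sum_nonneg fun i _ => div_nonneg (sq_nonneg _) (hσ i).le
  -- Each summand is weighted so that Cauchy–Schwarz over i produces exactly c d² and W.
  have hSabs : |S| ≤ ∑ i, ‖L i‖ * √(τ 1 * σ 0 i) * d * (‖v n i - vbar i‖ / √(τ 1 * σ 0 i)) := by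
    refine (Finset.abs_sum_le_sum_abs _ _).trans (Finset.sum_le_sum fun i _ => ?_)
    have h1 : |inner ℝ (L i (x (n + 1) - x n)) (v n i - vbar i)|
        ≤ ‖L i‖ * d * ‖v n i - vbar i‖ :=
      (abs_real_inner_le_norm _ _).trans
        (mul_le_mul_of_nonneg_right ((L i).le_opNorm _) (norm_nonneg _))
    refine h1.trans (le_of_eq ?_)
    have := (Real.sqrt_pos.2 (hσ i)).ne'
    field_simp
  have hCS := Finset.sum_mul_sq_le_sq_mul_sq Finset.univ
    (fun i => ‖L i‖ * √(τ 1 * σ 0 i) * d) (fun i => ‖v n i - vbar i‖ / √(τ 1 * σ 0 i))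
  have h1 : ∑ i, (‖L i‖ * √(τ 1 * σ 0 i) * d) ^ 2 = c * d ^ 2 := by
    rw [hc, Finset.mul_sum, Finset.sum_mul]
    refine Finset.sum_congr rfl fun i _ => ?_
    rw [mul_pow, mul_pow, Real.sq_sqrt (hσ i).le]
    ring
  have h2 : ∑ i, (‖v n i - vbar i‖ / √(τ 1 * σ 0 i)) ^ 2 = W := by
    refine Finset.sum_congr rfl fun i _ => ?_
    rw [div_pow, Real.sq_sqrt (hσ i).le]
  rw [h1, h2] at hCS
  have hS2 : S ^ 2 ≤ c * W * d ^ 2 := by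
    have := pow_le_pow_left₀ (abs_nonneg S) hSabs 2
    rw [sq_abs] at this
    linarith
  have habs : 2 * |S| * τ n ≤ d ^ 2 + c * W * τ n ^ 2 := by
    refine abs_le_of_sq_le_sq' ?_ (by positivity) |>.2
    have h3 : (2 * |S| * τ n) ^ 2 = 4 * S ^ 2 * τ n ^ 2 := by
      rw [mul_pow, mul_pow, sq_abs]; ring
    rw [h3]
    nlinarith [sq_nonneg (d ^ 2 - c * W * τ n ^ 2),
      mul_le_mul_of_nonneg_right hS2 (sq_nonneg (τ n))]
  have h4 : -(2 / τ n * S) ≤ d ^ 2 / τ n ^ 2 + c * W := by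
    have h5 : -(2 / τ n * S) ≤ 2 / τ n * |S| := by
      rw [← mul_neg]
      exact mul_le_mul_of_nonneg_left (neg_le_abs S) (by positivity)
    refine h5.trans ?_
    have h6 : 2 / τ n * |S| = (2 * |S| * τ n) / τ n ^ 2 := by field_simp
    have h7 : d ^ 2 / τ n ^ 2 + c * W = (d ^ 2 + c * W * τ n ^ 2) / τ n ^ 2 := by field_simp
    rw [h6, h7]
    gcongr
  linarith

end IsAlgorithm

end Algorithm

/-! ### Asymptotics of the step sizes and the rate -/

section Rates

variable {H : Type*} [NormedAddCommGroup H] [InnerProductSpace ℝ H] [CompleteSpace H]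
  {m : ℕ} {G : Fin m → Type*} [∀ i, NormedAddCommGroup (G i)]
  [∀ i, InnerProductSpace ℝ (G i)] [∀ i, CompleteSpace (G i)]
  {z : H} {f : H → EReal} {h : H → ℝ} {r : ∀ i, G i} {g : ∀ i, G i → EReal}
  {L : ∀ i, H →L[ℝ] G i} {γ η lam : ℝ} {τ θ : ℕ → ℝ}
  {σ : ℕ → Fin m → ℝ} {x y : ℕ → H} {v : ℕ → ∀ i, G i}

namespace IsAlgorithm

theorem tau_succ_eq (A : IsAlgorithm z f h r g L γ η lam τ θ σ x y v) (n : ℕ) :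
    τ (n + 1) = τ n / √(1 + τ n * (2 * γ - η * τ n) / lam) := by
  rw [A.tau_succ, A.theta_eq, one_div_mul_eq_div]

/-- The sequence decreases, and a positive limit would be a fixed point of a map that strictly
shrinks every t > 0 with ηt < 2γ. -/
theorem tendsto_tau_zero (A : IsAlgorithm z f h r g L γ η lam τ θ σ x y v) (hη : 0 < η) :
    Tendsto τ atTop (𝓝 0) := by
  have hl := A.lam_pos hη
  have hanti : Antitone τ := antitone_nat_of_succ_le fun n => by
    rw [A.tau_succ_eq]
    exact div_le_self (A.tau_pos' hη n).le (Real.one_le_sqrt.2 (A.radicand hη n).le)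
  have hlim := tendsto_atTop_ciInf hanti ⟨0, by rintro _ ⟨n, rfl⟩; exact (A.tau_pos' hη n).le⟩
  set l := ⨅ n, τ n
  have hl0 : 0 ≤ l := ge_of_tendsto' hlim fun n => (A.tau_pos' hη n).le
  have hl1 : l ≤ τ 0 := le_of_tendsto' hlim fun n => (A.tau_pos_le hη n).2
  rcases hl0.eq_or_lt with h0 | h0
  · rwa [← h0] at hlim
  exfalso
  have hηl : η * l < 2 * γ :=
    (mul_le_mul_of_nonneg_left hl1 hη.le).trans_lt (A.eta_mul_tau_zero_lt hη)
  have hD := one_lt_radicand hl h0 hηl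
  have hs : 1 < √(1 + l * (2 * γ - η * l) / lam) := by
    rw [Real.lt_sqrt zero_le_one]; simpa using hD
  have h1 : Tendsto (fun n => τ n / √(1 + τ n * (2 * γ - η * τ n) / lam)) atTop
      (𝓝 (l / √(1 + l * (2 * γ - η * l) / lam))) :=
    hlim.div (Real.continuous_sqrt.continuousAt.tendsto.comp
      (tendsto_const_nhds.add ((hlim.mul
        (tendsto_const_nhds.sub (tendsto_const_nhds.mul hlim))).div_const lam))) (by linarith)
  have h2 := tendsto_nhds_unique ((tendsto_add_atTop_iff_nat 1).2 hlim)
    (h1.congr fun n => (A.tau_succ_eq n).symm)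
  rw [eq_div_iff (by linarith)] at h2
  nlinarith

/-- With s the square root in the recursion, the increment is (s - 1)/τ. Rationalizing gives (2γ -
ητ)/λ divided by s + 1, and s → 1. -/
theorem tendsto_inv_tau_diff (A : IsAlgorithm z f h r g L γ η lam τ θ σ x y v) (hη : 0 < η) :
    Tendsto (fun n => (τ (n + 1))⁻¹ - (τ n)⁻¹) atTop (𝓝 (γ / lam)) := by
  have hl := A.lam_pos hη
  have h0 := A.tendsto_tau_zero hη
  have h1 : Tendsto (fun n => (2 * γ - η * τ n) / lam
      / (√(1 + τ n * (2 * γ - η * τ n) / lam) + 1)) atTop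
      (𝓝 ((2 * γ - η * 0) / lam / (√(1 + 0 * (2 * γ - η * 0) / lam) + 1))) := by
    refine Tendsto.div ((tendsto_const_nhds.sub (tendsto_const_nhds.mul h0)).div_const lam)
      ((Real.continuous_sqrt.continuousAt.tendsto.comp
      (tendsto_const_nhds.add ((h0.mul
        (tendsto_const_nhds.sub (tendsto_const_nhds.mul h0))).div_const lam))).add_const 1) ?_
    positivity
  have h2 : (2 * γ - η * 0) / lam / (√(1 + 0 * (2 * γ - η * 0) / lam) + 1) = γ / lam := by
    simp only [mul_zero, sub_zero, zero_mul, zero_div, add_zero, Real.sqrt_one]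
    ring
  rw [h2] at h1
  refine h1.congr fun n => ?_
  have ht := A.tau_pos' hη n
  have hD := A.radicand hη n
  rw [A.tau_succ_eq, inv_div]
  have hsq := Real.sq_sqrt (zero_le_one.trans hD.le)
  set s := √(1 + τ n * (2 * γ - η * τ n) / lam)
  have hs : 0 ≤ s := Real.sqrt_nonneg _
  have h3 : (2 * γ - η * τ n) / lam = (s ^ 2 - 1) / τ n := by
    rw [hsq]; field_simp; ring
  rw [h3, div_div, div_eq_iff (by positivity)]
  field_simp
  ring

/-- The step sizes decrease like `lam / (γ n)`. -/
theorem tendsto_mul_tau (A : IsAlgorithm z f h r g L γ η lam τ θ σ x y v) (hη : 0 < η)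
    (hγ : 0 < γ) : Tendsto (fun n : ℕ => (n : ℝ) * τ n) atTop (𝓝 (lam / γ)) := by
  have hl := A.lam_pos hη
  have h1 := (A.tendsto_inv_tau_diff hη).cesaro
  have h2 : Tendsto (fun n : ℕ => (n : ℝ)⁻¹ * (τ 0)⁻¹) atTop (𝓝 (0 * (τ 0)⁻¹)) :=
    tendsto_inv_atTop_nhds_zero_nat.mul_const _
  have h3 := h1.add h2
  rw [zero_mul, add_zero] at h3
  have h4 := h3.inv₀ (by positivity)
  rw [inv_div] at h4
  refine h4.congr fun n => ?_
  rw [Finset.sum_range_sub (fun n => (τ n)⁻¹), ← mul_add, sub_add_cancel, mul_inv, inv_inv,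
    inv_inv]

theorem isBigO (A : IsAlgorithm z f h r g L γ η lam τ θ σ x y v) (hf : IsGamma f)
    (h_conv : ConvexOn ℝ Set.univ h) (h_diff : Differentiable ℝ h)
    (hη : 0 < η) (h_lip : ∀ x y, ‖∇ h x - ∇ h y‖ ≤ η * ‖x - y‖) (hg : ∀ i, IsGamma (g i))
    (hγ : 0 < γ)
    (h_strong : IsStronglyConvex γ (fun x => f x + (h x : EReal))) {xbar : H} {vbar : ∀ i, G i}
    (hoc : OptimalityConditions z f h r g L xbar vbar) :
    (fun n : ℕ => ‖x n - xbar‖) =O[atTop] (fun n : ℕ => 1 / (n : ℝ)) := by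
  have hl := A.lam_pos hη
  set C := energy L lam τ σ x v xbar vbar 0
  have hbound : ∀ n, ‖x (n + 1) - xbar‖ ≤ √(C / lam) * τ (n + 1) := by
    intro n
    have ht := A.tau_pos' hη (n + 1)
    have h1 := A.estimate hf h_conv h_diff hη h_lip hg h_strong hoc n
    have h2 : 0 ≤ (1 - τ 1 * ∑ i, σ 0 i * ‖L i‖ ^ 2)
        * ∑ i, ‖v n i - vbar i‖ ^ 2 / (τ 1 * σ 0 i) :=
      mul_nonneg (sub_nonneg.2 (A.step_le_one hη)) (Finset.sum_nonneg fun i _ =>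
        div_nonneg (sq_nonneg _) (mul_pos (A.tau_pos' hη 1) (A.sigma_pos i)).le)
    have h3 : lam * ‖x (n + 1) - xbar‖ ^ 2 / τ (n + 1) ^ 2 ≤ C := by linarith
    have h4 : (‖x (n + 1) - xbar‖ / τ (n + 1)) ^ 2 ≤ C / lam := by
      rw [le_div_iff₀ hl, div_pow]
      refine le_trans (le_of_eq ?_) h3
      ring
    rw [← div_le_iff₀ ht]
    exact Real.le_sqrt_of_sq_le h4
  have h1 : (fun n : ℕ => ‖x n - xbar‖) =O[atTop] τ := by
    refine IsBigO.of_bound (√(C / lam)) ?_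
    filter_upwards [eventually_ge_atTop 1] with n hn
    obtain ⟨k, rfl⟩ := Nat.exists_eq_add_of_le' hn
    rw [norm_norm, Real.norm_of_nonneg (A.tau_pos' hη _).le]
    exact hbound k
  refine h1.trans ?_
  have h2 := (A.tendsto_mul_tau hη hγ).isBigO_one ℝ
  have h3 := h2.mul (isBigO_refl (fun n : ℕ => 1 / (n : ℝ)) atTop)
  simp only [one_mul] at h3
  refine (IsBigO.of_bound 1 ?_).trans h3
  filter_upwards [eventually_ge_atTop 1] with n hn
  have hn' : (n : ℝ) ≠ 0 := by positivity
  rw [one_mul]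
  refine le_of_eq (congrArg _ ?_)
  field_simp

end IsAlgorithm

end Rates

/-! ### The perturbed problem and strong duality -/

section Duality

theorem le_conj {E : Type*} [NormedAddCommGroup E] [InnerProductSpace ℝ E] {f : E → EReal}
    {x v : E} {a : ℝ} (hx : f x ≤ a) : ((inner ℝ v x - a : ℝ) : EReal) ≤ conj f v := by
  rw [EReal.coe_sub]
  exact (EReal.sub_le_sub le_rfl hx).trans
    (le_iSup (fun x => ((inner ℝ v x : ℝ) : EReal) - f x) x)

section PerturbedProblem

variable {H : Type*} [NormedAddCommGroup H] [InnerProductSpace ℝ H]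
  {m : ℕ} {G : Fin m → Type*} [∀ i, NormedAddCommGroup (G i)]
  [∀ i, InnerProductSpace ℝ (G i)]
  {z : H} {f : H → EReal} {h : H → ℝ} {r : ∀ i, G i} {g : ∀ i, G i → EReal}
  {L : ∀ i, H →L[ℝ] G i} {γ : ℝ}

/-- Since no summand is ⊥, a finite total forces each to be finite; later arguments can then handle
real bounds term by term. -/
theorem primalObj_le_iff (hf : ∀ x, f x ≠ ⊥) (hg : ∀ i u, g i u ≠ ⊥) (x : H) (t : ℝ) :
    primalObj z f h r g L x ≤ t ↔ ∃ (a : ℝ) (b : Fin m → ℝ), f x ≤ a ∧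
      (∀ i, g i (L i x - r i) ≤ b i) ∧ a + ∑ i, b i + h x - inner ℝ x z ≤ t := by
  unfold primalObj
  rw [sub_coe_le_coe_iff, add_coe_le_coe_iff]
  constructor
  · intro hle
    have htop := (hle.trans_lt (EReal.coe_lt_top _)).ne
    have hbs : ∑ i, g i (L i x - r i) ≠ ⊥ := sum_ne_bot fun i => hg i _
    obtain ⟨h1, h2⟩ := (EReal.add_ne_top_iff_ne_top₂ (hf x) hbs).1 htop
    have h3 := ne_top_of_sum_ne_top (fun i => hg i (L i x - r i)) h2
    obtain ⟨a, ha⟩ := exists_coe_eq (hf x) h1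
    choose b hb using fun i => exists_coe_eq (hg i (L i x - r i)) (h3 i (Finset.mem_univ i))
    refine ⟨a, b, ha.le, fun i => (hb i).le, ?_⟩
    simp only [ha, hb, coe_sum_real] at hle
    have : a + ∑ i, b i ≤ t + inner ℝ x z - h x := by exact_mod_cast hle
    linarith
  · rintro ⟨a, b, ha, hb, hle⟩
    refine (add_le_add ha (Finset.sum_le_sum fun i _ => hb i)).trans ?_
    rw [coe_sum_real]
    have : a + ∑ i, b i ≤ t + inner ℝ x z - h x := by linarith
    exact_mod_cast this

/-- The epigraph of the perturbed primal objective. -/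
def perturbedEpigraph (z : H) (f : H → EReal) (h : H → ℝ) (r : ∀ i, G i) (g : ∀ i, G i → EReal)
    (L : ∀ i, H →L[ℝ] G i) : Set (H × (∀ i, G i) × ℝ) :=
  {p | primalObj z f h (r - p.2.1) g L p.1 ≤ (p.2.2 : EReal)}

theorem mem_perturbedEpigraph_iff (hf : ∀ x, f x ≠ ⊥) (hg : ∀ i u, g i u ≠ ⊥)
    (p : H × (∀ i, G i) × ℝ) :
    p ∈ perturbedEpigraph z f h r g L ↔ ∃ (a : ℝ) (b : Fin m → ℝ), f p.1 ≤ a ∧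
      (∀ i, g i (L i p.1 - (r i - p.2.1 i)) ≤ b i) ∧
        a + ∑ i, b i + h p.1 - inner ℝ p.1 z ≤ p.2.2 :=
  primalObj_le_iff hf hg p.1 p.2.2

theorem lowerSemicontinuous_comp_continuous {X Z : Type*} [TopologicalSpace X]
    [TopologicalSpace Z] {f : X → EReal} (hf : LowerSemicontinuous f) {k : Z → X}
    (hk : Continuous k) : LowerSemicontinuous fun p => f (k p) :=
  fun p a ha => hk.continuousAt.eventually (hf (k p) a ha)

theorem isClosed_perturbedEpigraph (hf : IsGamma f) (hg : ∀ i, IsGamma (g i))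
    (h_cont : Continuous h) : IsClosed (perturbedEpigraph z f h r g L) := by
  have h1 : LowerSemicontinuous fun p : H × (∀ i, G i) =>
      primalObj z f h (r - p.2) g L p.1 := by
    unfold primalObj
    have hs : ∀ p : H × (∀ i, G i), ∑ i, g i (L i p.1 - (r - p.2) i) ≠ ⊥ :=
      fun p => sum_ne_bot fun i => (hg i).proper.2 _
    have h2 := lowerSemicontinuous_add_of_ne_bot
      (lowerSemicontinuous_comp_continuous (Z := H × (∀ i, G i)) hf.lsc continuous_fst)
      (lowerSemicontinuous_sum_of_ne_bot (s := Finset.univ)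
        (f := fun i (p : H × (∀ i, G i)) => g i (L i p.1 - (r - p.2) i))
        (fun i => lowerSemicontinuous_comp_continuous (hg i).lsc (by
          simp only [Pi.sub_apply]; fun_prop))
        fun i p => (hg i).proper.2 _) (fun p => hf.proper.2 _) hs
    have h3 := lowerSemicontinuous_add_coe h2
      (fun p => EReal.add_ne_bot_iff.2 ⟨hf.proper.2 _, hs p⟩)
      (u := fun p => h p.1) (h_cont.comp continuous_fst)
    have h4 := lowerSemicontinuous_add_coe h3
      (fun p => EReal.add_ne_bot_iff.2
        ⟨EReal.add_ne_bot_iff.2 ⟨hf.proper.2 _, hs p⟩, EReal.coe_ne_bot _⟩)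
      (u := fun p => -inner ℝ p.1 z) (by fun_prop)
    simpa only [sub_eq_add_neg, EReal.coe_neg] using h4
  exact (isClosed_epigraph_real h1).preimage (by fun_prop :
    Continuous fun p : H × (∀ i, G i) × ℝ => ((p.1, p.2.1), p.2.2))

/-- f and h must stay together, as only their sum is strongly convex. The surplus in x gives
closedness of the projection and uniqueness of the minimizer. -/
theorem perturbedEpigraph_combo (hf : ∀ x, f x ≠ ⊥) (hg : ∀ i, IsGamma (g i))
    (h_strong : IsStronglyConvex γ (fun x => f x + (h x : EReal)))
    {p q : H × (∀ i, G i) × ℝ} (hp : p ∈ perturbedEpigraph z f h r g L)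
    (hq : q ∈ perturbedEpigraph z f h r g L) {a b : ℝ} (ha : 0 ≤ a) (hb : 0 ≤ b)
    (hab : a + b = 1) :
    (a • p.1 + b • q.1, a • p.2.1 + b • q.2.1,
      a * p.2.2 + b * q.2.2 - γ / 2 * (a * b) * ‖p.1 - q.1‖ ^ 2)
      ∈ perturbedEpigraph z f h r g L := by
  have hg' : ∀ i u, g i u ≠ ⊥ := fun i => (hg i).proper.2
  rw [mem_perturbedEpigraph_iff hf hg'] at hp hq ⊢
  obtain ⟨α, β, h1, h2, h3⟩ := hp
  obtain ⟨α', β', h1', h2', h3'⟩ := hq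
  have h4 := h_strong.combo_le (x := p.1) (y := q.1) (s := α + h p.1) (t := α' + h q.1)
    ((add_coe_le_coe_iff _ _ _).2 (by simpa using h1))
    ((add_coe_le_coe_iff _ _ _).2 (by simpa using h1')) ha hb hab
  rw [add_coe_le_coe_iff] at h4
  refine ⟨_, fun i => a * β i + b * β' i, h4, fun i => ?_, ?_⟩
  · have h5 := (hg i).convex.combo_le (h2 i) (h2' i) ha hb hab
    convert h5 using 2
    obtain rfl : b = 1 - a := by linarith
    simp only [map_add, map_smul, Pi.add_apply, Pi.smul_apply]
    module
  · simp only [Finset.sum_add_distrib, ← Finset.mul_sum, inner_add_left, inner_smul_left,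
      conj_trivial]
    have h5 := mul_le_mul_of_nonneg_left h3 ha
    have h6 := mul_le_mul_of_nonneg_left h3' hb
    linarith

/-- Affine minorants of f + h - (γ/2)‖·‖² and of each gᵢ leave a linear form in x, which the
quadratic term dominates; only an affine function of y remains. -/
theorem exists_perturbedEpigraph_minorant (hf : IsGamma f) (hg : ∀ i, IsGamma (g i))
    (h_cont : Continuous h) (hγ : 0 < γ)
    (h_strong : IsStronglyConvex γ (fun x => f x + (h x : EReal))) :
    ∃ b : (∀ i, G i) → ℝ, Continuous b ∧
      ∀ p ∈ perturbedEpigraph z f h r g L, b p.2.1 ≤ p.2.2 := by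
  have hgamma : IsGamma fun x => f x + (h x : EReal) - ((γ / 2 * ‖x‖ ^ 2 : ℝ) : EReal) := by
    have hbot : ∀ x, f x + (h x : EReal) ≠ ⊥ := fun x =>
      EReal.add_ne_bot_iff.2 ⟨hf.proper.2 x, EReal.coe_ne_bot _⟩
    refine ⟨⟨?_, fun x => ?_⟩, h_strong, ?_⟩
    · obtain ⟨x₀, hx₀⟩ := hf.proper.1
      obtain ⟨a, ha⟩ := exists_coe_eq (hf.proper.2 x₀) (ne_of_lt hx₀)
      refine ⟨x₀, ?_⟩
      have : f x₀ + (h x₀ : EReal) - ((γ / 2 * ‖x₀‖ ^ 2 : ℝ) : EReal)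
          = ((a + h x₀ - γ / 2 * ‖x₀‖ ^ 2 : ℝ) : EReal) := by rw [ha]; norm_cast
      exact (this ▸ EReal.coe_lt_top _ : _ < ⊤)
    · change f x + (h x : EReal) - ((γ / 2 * ‖x‖ ^ 2 : ℝ) : EReal) ≠ ⊥
      rw [sub_eq_add_neg, ← EReal.coe_neg]
      exact EReal.add_ne_bot_iff.2 ⟨hbot x, EReal.coe_ne_bot _⟩
    · have := lowerSemicontinuous_add_coe
        (lowerSemicontinuous_add_coe hf.lsc hf.proper.2 h_cont) hbot
        (u := fun x => -(γ / 2 * ‖x‖ ^ 2)) (by fun_prop)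
      simpa only [sub_eq_add_neg, EReal.coe_neg] using this
  obtain ⟨l, c, hl⟩ := exists_affine_minorant hgamma
  choose k d hk using fun i => exists_affine_minorant (hg i)
  set l' : StrongDual ℝ H := l + ∑ i, (k i).comp (L i) - innerSL ℝ z with hl'
  refine ⟨fun y => -(‖l'‖ ^ 2 / (4 * (γ / 2))) + c + ∑ i, (k i (y i) - k i (r i) + d i),
    by fun_prop, fun p hp => ?_⟩
  obtain ⟨a, b, ha, hb, hle⟩ :=
    (mem_perturbedEpigraph_iff hf.proper.2 (fun i => (hg i).proper.2) p).1 hp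
  have h1 := hl p.1 (a + h p.1 - γ / 2 * ‖p.1‖ ^ 2) (by
    rw [sub_coe_le_coe_iff, add_coe_le_coe_iff]; simpa using ha)
  have h2 : ∑ i, (k i (L i p.1) + (k i (p.2.1 i) - k i (r i) + d i)) ≤ ∑ i, b i := by
    refine Finset.sum_le_sum fun i _ => ?_
    have := hk i _ _ (hb i)
    rw [map_sub, map_sub] at this
    linarith
  have h3 := linear_add_sq_bounded_below l' (half_pos hγ) p.1
  have h4 : l' p.1 = l p.1 + ∑ i, k i (L i p.1) - inner ℝ p.1 z := by
    rw [real_inner_comm, hl']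
    simp
  rw [h4] at h3
  rw [Finset.sum_add_distrib] at h2
  linarith

end PerturbedProblem

variable {H : Type*} [NormedAddCommGroup H] [InnerProductSpace ℝ H] [CompleteSpace H]
  {m : ℕ} {G : Fin m → Type*} [∀ i, NormedAddCommGroup (G i)]
  [∀ i, InnerProductSpace ℝ (G i)] [∀ i, CompleteSpace (G i)]
  {z : H} {f : H → EReal} {h : H → ℝ} {r : ∀ i, G i} {g : ∀ i, G i → EReal}
  {L : ∀ i, H →L[ℝ] G i} {γ : ℝ}

/-- Sum the Fenchel–Young inequalities of f, h and all gᵢ; the adjoints cancel the pairings of vᵢ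
with Lᵢx. -/
theorem weak_duality (hf : ∀ x, f x ≠ ⊥) (hg : ∀ i u, g i u ≠ ⊥) (x : H) (v : ∀ i, G i) :
    dualObj z f h r g L v ≤ primalObj z f h r g L x := by
  refine le_of_forall_coe_ge fun t ht => ?_
  obtain ⟨a, b, ha, hb, hle⟩ := (primalObj_le_iff hf hg x t).1 ht
  set u := z - ∑ i, (L i).adjoint (v i) with hu
  have h1 : ((inner ℝ u x - a - h x : ℝ) : EReal)
      ≤ infConv (conj f) (conj fun x => (h x : EReal)) u := by
    refine le_iInf fun y => ?_
    have h2 : inner ℝ u x - a - h x = (inner ℝ y x - a) + (inner ℝ (u - y) x - h x) := by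
      rw [inner_sub_left u y]; ring
    rw [h2, EReal.coe_add]
    exact add_le_add (le_conj ha) (le_conj (f := fun x => (h x : EReal)) le_rfl)
  have h3 : ((∑ i, (inner ℝ (v i) (L i x) - b i) : ℝ) : EReal)
      ≤ ∑ i, (conj (g i) (v i) + ((inner ℝ (v i) (r i) : ℝ) : EReal)) := by
    rw [← coe_sum_real]
    refine Finset.sum_le_sum fun i _ => ?_
    have h4 : inner ℝ (v i) (L i x) - b i
        = (inner ℝ (v i) (L i x - r i) - b i) + inner ℝ (v i) (r i) := by
      rw [inner_sub_right]; ring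
    rw [h4, EReal.coe_add]
    exact add_le_add (le_conj (hb i)) le_rfl
  have h5 : inner ℝ u x = inner ℝ x z - ∑ i, inner ℝ (v i) (L i x) := by
    rw [hu, inner_sub_left, sum_inner, real_inner_comm]
    simp only [ContinuousLinearMap.adjoint_inner_left]
  refine (EReal.sub_le_sub (EReal.neg_le_neg_iff.2 h1) h3).trans ?_
  rw [← EReal.coe_neg, ← EReal.coe_sub, EReal.coe_le_coe_iff, h5, Finset.sum_sub_distrib]
  linarith

/-- The product carries the sup norm, so Riesz representation is applied in each factor. -/
theorem exists_dual_coordinates (w : StrongDual ℝ (∀ i, G i)) :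
    ∃ v : ∀ i, G i, ∀ y, w y = ∑ i, inner ℝ (v i) (y i) := by
  refine ⟨fun i => (InnerProductSpace.toDual ℝ (G i)).symm
    (w.comp (ContinuousLinearMap.single ℝ G i)), fun y => ?_⟩
  simp only [InnerProductSpace.toDual_symm_apply]
  exact (ContinuousLinearMap.sum_comp_single ℝ G w y).symm

/-- Existence and uniqueness of a primal solution, and existence of multipliers. -/
theorem exists_solution (hf : IsGamma f) (h_diff : Differentiable ℝ h)
    (hg : ∀ i, IsGamma (g i)) (hγ : 0 < γ)
    (h_strong : IsStronglyConvex γ (fun x => f x + (h x : EReal)))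
    (h_qual : QualificationCondition f r g L) :
    ∃ xbar : H, IsMinOn (primalObj z f h r g L) Set.univ xbar ∧
      (∀ x : H, IsMinOn (primalObj z f h r g L) Set.univ x → x = xbar) ∧
      ∃ vbar : ∀ i, G i, OptimalityConditions z f h r g L xbar vbar := by
  have hf' := hf.proper.2
  have hg' : ∀ i u, g i u ≠ ⊥ := fun i => (hg i).proper.2
  have h_cont := h_diff.continuous
  set E := perturbedEpigraph z f h r g L with hE
  have hEiff : ∀ p, p ∈ E ↔ _ := mem_perturbedEpigraph_iff hf' hg'
  have hcombo := @perturbedEpigraph_combo _ _ _ _ _ _ _ z f h r g L γ hf' hg h_strong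
  rw [← hE] at hcombo
  have hup : ∀ x y t s, (x, y, t) ∈ E → t ≤ s → (x, y, s) ∈ E := fun x y t s h1 h2 =>
    le_trans (show primalObj z f h (r - y) g L x ≤ (t : EReal) from h1)
      (EReal.coe_le_coe_iff.2 h2)
  obtain ⟨b, hb, hbE⟩ := exists_perturbedEpigraph_minorant (z := z) (r := r) (L := L) hf hg h_cont
    hγ h_strong
  set P := Prod.snd '' E with hP
  have hPc : IsClosed P := by
    -- γ/8 is (γ/2)ab at a = b = 1/2.
    refine isClosed_image_snd_of_uniformlyConvex
      (isClosed_perturbedEpigraph hf hg h_cont) (κ := γ / 8) (by positivity) ?_ hup hb hbE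
    intro p hp q hq
    have h1 := hcombo hp hq (a := 1 / 2) (b := 1 / 2) (by norm_num) (by norm_num) (by norm_num)
    convert h1 using 3
    ring
  have hPconv : Convex ℝ P := by
    rintro _ ⟨p, hp, rfl⟩ _ ⟨q, hq, rfl⟩ a b ha hb hab
    refine ⟨_, hup _ _ _ (a * p.2.2 + b * q.2.2) (hcombo hp hq ha hb hab) ?_, rfl⟩
    have : 0 ≤ γ / 2 * (a * b) * ‖p.1 - q.1‖ ^ 2 := by positivity
    linarith
  have hPup : ∀ y t s, (y, t) ∈ P → t ≤ s → (y, s) ∈ P := by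
    rintro y t s ⟨⟨x, y', t'⟩, hp, hpe⟩ hts
    obtain ⟨rfl, rfl⟩ := Prod.mk.inj hpe
    exact ⟨(x, y', s), hup _ _ _ _ hp hts, rfl⟩
  obtain ⟨hrS, V, hVc, hV⟩ := h_qual
  set S := (fun (x : H) (i : Fin m) => L i x) '' dom f - Set.univ.pi fun i => dom (g i) with hS
  have hPV : ∀ q ∈ P, q.1 ∈ V := by
    rintro _ ⟨p, hp, rfl⟩
    obtain ⟨a, β, ha, hβ, -⟩ := (hEiff p).1 hp
    -- The argument u = Lx - (r - y) of g gives -y = (Lx - u) - r, so the domain of the value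
    -- function is -(S - r).
    rw [← neg_mem_iff]
    have h1 : -p.2.1 ∈ ⋃ (t : ℝ) (_ : 0 < t), t • (S - {r}) := by
      refine Set.mem_iUnion₂.2 ⟨1, one_pos, ?_⟩
      rw [one_smul]
      refine ⟨fun i => L i p.1 - (L i p.1 - (r i - p.2.1 i)), ⟨_, ⟨p.1, ?_, rfl⟩,
        fun i => L i p.1 - (r i - p.2.1 i), ?_, rfl⟩, r, rfl, ?_⟩
      · exact ha.trans_lt (EReal.coe_lt_top _)
      · exact fun i _ => (hβ i).trans_lt (EReal.coe_lt_top _)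
      · ext i
        simp
    rw [hV] at h1
    exact h1
  have hfin : ∀ (x : H) (y : ∀ i, G i), x ∈ dom f → (∀ i, L i x - (r i - y i) ∈ dom (g i)) →
      ∃ s, (y, s) ∈ P := by
    intro x y hx hy
    obtain ⟨a, ha⟩ := exists_coe_eq (hf' x) (ne_of_lt hx)
    choose β hβ using fun i => exists_coe_eq (hg' i _) (ne_of_lt (hy i))
    exact ⟨a + ∑ i, β i + h x - inner ℝ x z, (x, y, _),
      (hEiff _).2 ⟨a, β, ha.le, fun i => (hβ i).le, le_rfl⟩, rfl⟩
  have hVP : ∀ y ∈ V, ∃ t : ℝ, 0 < t ∧ ∃ s, (t • y, s) ∈ P := by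
    intro y hy
    have h1 : -y ∈ (V : Set (∀ i, G i)) := neg_mem hy
    rw [← hV] at h1
    obtain ⟨t, ht, h2⟩ := Set.mem_iUnion₂.1 h1
    obtain ⟨_, ⟨_, ⟨_, ⟨x, hx, rfl⟩, u, hu, rfl⟩, r', rfl, rfl⟩, h3⟩ := h2
    refine ⟨t⁻¹, inv_pos.2 ht, hfin x _ hx fun i => ?_⟩
    have h4 : L i x - (r' i - (t⁻¹ • y) i) = u i := by
      have h5 := congrFun h3 i
      simp only [Pi.smul_apply, Pi.sub_apply, Pi.neg_apply] at h5
      rw [Pi.smul_apply, ← neg_neg (y i), ← h5, smul_neg, smul_smul, inv_mul_cancel₀ ht.ne',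
        one_smul]
      abel
    rw [h4]
    exact hu i (Set.mem_univ i)
  set T : Set ℝ := {t | ((0 : ∀ i, G i), t) ∈ P} with hT
  have hTc : IsClosed T := hPc.preimage
    (by fun_prop : Continuous fun s : ℝ => ((0 : ∀ i, G i), s))
  have hTb : BddBelow T := by
    refine ⟨b 0, ?_⟩
    rintro s ⟨p, hp, hps⟩
    have := hbE p hp
    rwa [hps] at this
  have hTn : T.Nonempty := by
    obtain ⟨t, ht, s, hs⟩ := hVP 0 V.zero_mem
    rw [smul_zero] at hs
    exact ⟨s, hs⟩
  have hpT := hTc.csInf_mem hTn hTb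
  have hmin : ∀ t ∈ T, sInf T ≤ t := fun t ht => csInf_le hTb ht
  set p := sInf T
  obtain ⟨⟨xbar, y₀, p'⟩, hxE, hxe⟩ := hpT
  obtain ⟨rfl, rfl⟩ : y₀ = 0 ∧ p' = p := Prod.mk.inj hxe
  have hE0 : ∀ (x : H) (t : ℝ), primalObj z f h r g L x ≤ t ↔ (x, (0 : ∀ i, G i), t) ∈ E := by
    intro x t
    change _ ↔ primalObj z f h (r - 0) g L x ≤ t
    rw [sub_zero]
  have hmem : ∀ (x : H) (t : ℝ), (x, (0 : ∀ i, G i), t) ∈ E → t ∈ T := fun x t ht => ⟨_, ht, rfl⟩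
  obtain ⟨w, hw⟩ := exists_subgradient_of_cone_closed hPc hPconv hPup
    (show ((0 : ∀ i, G i), p) ∈ P from ⟨_, hxE, rfl⟩) hmin V hVc hPV hVP
  obtain ⟨v, hv⟩ := exists_dual_coordinates w
  obtain ⟨a₀, b₀, ha₀, hb₀, hle⟩ := (hEiff _).1 hxE
  simp only [Pi.zero_apply, sub_zero] at ha₀ hb₀ hle
  obtain ⟨a, ha⟩ := exists_coe_eq_of_le (hf' _) ha₀
  choose β hβ using fun i => exists_coe_eq_of_le (hg' i _) (hb₀ i)
  have hle' : a + ∑ i, β i + h xbar - inner ℝ xbar z ≤ p := by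
    rw [ha] at ha₀
    have h1 : ∑ i, β i ≤ ∑ i, b₀ i := Finset.sum_le_sum fun i _ => by
      have := hb₀ i
      rw [hβ] at this
      exact_mod_cast this
    have h2 : a ≤ a₀ := by exact_mod_cast ha₀
    linarith
  -- The subgradient inequality for the value function, before minimizing over x. Both optimality
  -- conditions are special cases.
  have hsub : ∀ (x : H) (y : ∀ i, G i) (s : ℝ) (β' : Fin m → ℝ), f x ≤ s →
      (∀ i, g i (L i x - (r i - y i)) ≤ β' i) →
      a + ∑ i, β i + h xbar - inner ℝ xbar z + ∑ i, inner ℝ (v i) (y i)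
        ≤ s + ∑ i, β' i + h x - inner ℝ x z := by
    intro x y s β' hs hβ'
    have h1 := hw (y, s + ∑ i, β' i + h x - inner ℝ x z)
      ⟨(x, y, _), (hEiff _).2 ⟨s, β', hs, hβ', le_rfl⟩, rfl⟩
    rw [hv] at h1
    dsimp only at h1
    linarith
  refine ⟨xbar, fun x _ => le_of_forall_coe_ge fun t ht => ?_, fun x hx => ?_, v, ?_, fun i => ?_⟩
  · exact ((hE0 _ _).2 hxE).trans
      (EReal.coe_le_coe_iff.2 (hmin t (hmem x t ((hE0 x t).1 ht))))
  · have h1 : (x, (0 : ∀ i, G i), p) ∈ E :=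
      (hE0 _ _).1 (le_trans (hx (Set.mem_univ xbar)) ((hE0 _ _).2 hxE))
    -- The midpoint of two distinct minimizers would fall below the minimum.
    have h2 := hcombo h1 hxE (a := 1 / 2) (b := 1 / 2) (by norm_num) (by norm_num) (by norm_num)
    simp only [smul_zero, add_zero] at h2
    have h3 := hmin _ (hmem _ _ h2)
    have h4 : ‖x - xbar‖ ^ 2 ≤ 0 := by
      by_contra hcon
      push Not at hcon
      nlinarith [mul_pos hγ hcon]
    have h5 : ‖x - xbar‖ = 0 := by nlinarith [norm_nonneg (x - xbar)]
    exact sub_eq_zero.1 (norm_eq_zero.1 h5)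
  · refine Set.mem_add.2 ⟨z - ∑ i, (L i).adjoint (v i) - ∇ h xbar, ?_, _, rfl, by abel⟩
    refine sub_mem_subdiff hf.convex ha (h_diff xbar).hasGradientAt fun y t hy => ?_
    -- This perturbation freezes every gᵢ at Lᵢx̄ - rᵢ while x varies, isolating f + h.
    have h1 := hsub y (fun i => L i xbar - L i y) t β hy fun i => by
      rw [← hβ i]
      exact le_of_eq (congrArg _ (by abel))
    rw [inner_sub_left, sum_inner]
    simp only [ContinuousLinearMap.adjoint_inner_left, map_sub]
    have h2 : ∑ i, inner ℝ (v i) (L i xbar - L i y) = -∑ i, inner ℝ (v i) (L i y - L i xbar) := by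
      rw [← Finset.sum_neg_distrib]
      exact Finset.sum_congr rfl fun i _ => by rw [← inner_neg_right, neg_sub]
    rw [h2] at h1
    rw [inner_sub_right, real_inner_comm y z, real_inner_comm xbar z]
    linarith
  · rw [mem_subdiff_iff (hβ i)]
    intro u t hu
    -- With x fixed at x̄, perturbing only coordinate i moves the argument of gᵢ to u and leaves the
    -- other terms unchanged.
    have h1 := hsub xbar (Pi.single i (u - (L i xbar - r i))) a
      (fun j => β j + if j = i then t - β i else 0) ha.le (fun j => by
        by_cases hj : j = i
        · subst hj
          rw [Pi.single_eq_same, if_pos rfl, add_sub_cancel]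
          refine le_trans (le_of_eq (congrArg _ ?_)) hu
          abel
        · rw [Pi.single_eq_of_ne hj, if_neg hj, add_zero, sub_zero, hβ])
    have h2 : ∑ j, inner ℝ (v j) ((Pi.single i (u - (L i xbar - r i)) : ∀ j, G j) j)
        = inner ℝ (v i) (u - (L i xbar - r i)) := by
      rw [Finset.sum_eq_single i (fun j _ hj => by rw [Pi.single_eq_of_ne hj, inner_zero_right])
        (fun hi => absurd (Finset.mem_univ i) hi), Pi.single_eq_same]
    rw [h2, Finset.sum_add_distrib, Finset.sum_ite_eq' Finset.univ i,
      if_pos (Finset.mem_univ i)] at h1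
    linarith

/-- The optimality conditions force equality of the primal and dual objective values. -/
theorem OptimalityConditions.primalObj_le_dualObj (h_conv : ConvexOn ℝ Set.univ h)
    (h_diff : Differentiable ℝ h) {xbar : H} {vbar : ∀ i, G i}
    (hoc : OptimalityConditions z f h r g L xbar vbar) :
    primalObj z f h r g L xbar ≤ dualObj z f h r g L vbar := by
  obtain ⟨u, hu, k, rfl, huk⟩ := Set.mem_add.1 hoc.1
  obtain ⟨a, ha⟩ := exists_coe_eq_of_mem_subdiff hu
  choose β hβ using fun i => exists_coe_eq_of_mem_subdiff (hoc.2 i)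
  have hk : ∇ h xbar ∈ subdiff (fun x => (h x : EReal)) xbar := by
    rw [mem_subdiff_iff (f := fun x => (h x : EReal)) rfl]
    intro y t ht
    exact (gradient_inequality h_conv (h_diff xbar).hasGradientAt y).trans (by exact_mod_cast ht)
  have h1 : infConv (conj f) (conj fun x => (h x : EReal))
      (z - ∑ i, (L i).adjoint (vbar i))
      ≤ (((inner ℝ u xbar - a) + (inner ℝ (∇ h xbar) xbar - h xbar) : ℝ) : EReal) := by
    -- Splitting the argument as u + ∇h(x̄) makes Fenchel–Young tight for both conjugates.
    refine (iInf_le _ u).trans ?_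
    rw [← huk, add_sub_cancel_left, conj_eq_of_mem_subdiff ha hu,
      conj_eq_of_mem_subdiff (f := fun x => (h x : EReal)) rfl hk, EReal.coe_add]
  have h2 : ∑ i, (conj (g i) (vbar i) + ((inner ℝ (vbar i) (r i) : ℝ) : EReal))
      = ((∑ i, (inner ℝ (vbar i) (L i xbar) - β i) : ℝ) : EReal) := by
    rw [← coe_sum_real]
    refine Finset.sum_congr rfl fun i _ => ?_
    rw [conj_eq_of_mem_subdiff (hβ i) (hoc.2 i), ← EReal.coe_add, inner_sub_right]
    congr 1
    ring
  have h3 : primalObj z f h r g L xbar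
      = ((a + ∑ i, β i + h xbar - inner ℝ xbar z : ℝ) : EReal) := by
    unfold primalObj
    simp only [ha, hβ, coe_sum_real]
    norm_cast
  have h4 : inner ℝ u xbar + inner ℝ (∇ h xbar) xbar
      = inner ℝ xbar z - ∑ i, inner ℝ (vbar i) (L i xbar) := by
    rw [← inner_add_left, huk, inner_sub_left, sum_inner, real_inner_comm]
    simp only [ContinuousLinearMap.adjoint_inner_left]
  rw [h3]
  refine le_trans ?_ (EReal.sub_le_sub (EReal.neg_le_neg_iff.2 h1) h2.le)
  rw [← EReal.coe_neg, ← EReal.coe_sub, EReal.coe_le_coe_iff, Finset.sum_sub_distrib]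
  linarith

end Duality

end PrimalDual

/-! ### The main theorem -/

theorem theorem4 {H : Type*} [NormedAddCommGroup H] [InnerProductSpace ℝ H] [CompleteSpace H]
    {m : ℕ} (hm : 0 < m) {G : Fin m → Type*} [∀ i, NormedAddCommGroup (G i)]
    [∀ i, InnerProductSpace ℝ (G i)] [∀ i, CompleteSpace (G i)]
    (z : H) (f : H → EReal) (h : H → ℝ) (r : ∀ i, G i) (g : ∀ i, G i → EReal)
    (L : ∀ i, H →L[ℝ] G i) (γ η : ℝ)
    (hf : IsGamma f)
    (h_conv : ConvexOn ℝ Set.univ h) (h_diff : Differentiable ℝ h)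
    (hη : 0 < η) (h_lip : ∀ x y, ‖∇ h x - ∇ h y‖ ≤ η * ‖x - y‖)
    (hg : ∀ i, IsGamma (g i)) (hL : ∀ i, L i ≠ 0)
    (hγ : 0 < γ) (h_strong : IsStronglyConvex γ (fun x => f x + (h x : EReal)))
    (h_qual : QualificationCondition f r g L) :
    ∃ xbar : H,
      -- `xbar` is the unique optimal solution of the primal problem
      IsMinOn (primalObj z f h r g L) Set.univ xbar ∧
      (∀ x : H, IsMinOn (primalObj z f h r g L) Set.univ x → x = xbar) ∧
      -- some optimal solution of the dual problem fulfils the optimality conditions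
      (∃ vbar : ∀ i, G i, IsMaxOn (dualObj z f h r g L) Set.univ vbar ∧
        OptimalityConditions z f h r g L xbar vbar) ∧
      -- the optimal objective values coincide
      (⨅ x, primalObj z f h r g L x) = (⨆ v, dualObj z f h r g L v) ∧
      -- convergence behaviour of the algorithm
      ∀ (lam : ℝ) (τ θ : ℕ → ℝ) (σ : ℕ → Fin m → ℝ) (x y : ℕ → H) (v : ℕ → ∀ i, G i),
        IsAlgorithm z f h r g L γ η lam τ θ σ x y v →
        (∀ vbar : ∀ i, G i, OptimalityConditions z f h r g L xbar vbar → ∀ n : ℕ,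
          lam * ‖x (n + 1) - xbar‖ ^ 2 / τ (n + 1) ^ 2
              + (1 - τ 1 * ∑ i, σ 0 i * ‖L i‖ ^ 2)
                * ∑ i, ‖v n i - vbar i‖ ^ 2 / (τ 1 * σ 0 i)
            ≤ lam * ‖x 1 - xbar‖ ^ 2 / τ 1 ^ 2
              + ∑ i, ‖v 0 i - vbar i‖ ^ 2 / (τ 1 * σ 0 i)
              + ‖x 1 - x 0‖ ^ 2 / τ 0 ^ 2
              + 2 / τ 0 * ∑ i, inner ℝ (L i (x 1 - x 0)) (v 0 i - vbar i)) ∧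
        Tendsto (fun n : ℕ => (n : ℝ) * τ n) atTop (𝓝 (lam / γ)) ∧
        (fun n : ℕ => ‖x n - xbar‖) =O[atTop] (fun n : ℕ => 1 / (n : ℝ)) := by
  have hf' := hf.proper.2
  have hg' : ∀ i u, g i u ≠ ⊥ := fun i => (hg i).proper.2
  obtain ⟨xbar, hmin, huniq, vbar, hoc⟩ :=
    exists_solution (z := z) hf h_diff hg hγ h_strong h_qual
  have hstrong := hoc.primalObj_le_dualObj h_conv h_diff
  refine ⟨xbar, hmin, huniq, ⟨vbar, fun v _ => (weak_duality hf' hg' xbar v).trans hstrong, hoc⟩,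
    le_antisymm ((iInf_le _ xbar).trans (hstrong.trans (le_iSup (dualObj z f h r g L) vbar)))
      (iSup_le fun v => le_iInf fun x => weak_duality hf' hg' x v),
    fun lam τ θ σ x y v A => ⟨fun vbar hoc n => ?_, A.tendsto_mul_tau hη hγ,
      A.isBigO hf h_conv h_diff hη h_lip hg hγ h_strong hoc⟩⟩
  exact A.estimate hf h_conv h_diff hη h_lip hg h_strong hoc n
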